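/- Theorem 4.5. For every integer $n\ge 0$ there is a constant $C_n$, depending only on $n$, with the following property. Let $M$ be a compact (Hausdorff, smooth, boundaryless) $n$-manifold, let $T$ be a real number, and let $(g(x,t),H(x,t))$, $x\in M$, $0\le t\le T$, be a solution of the generalized Ricci flow on $M$, that is, a family of Riemannian metrics $g(t)=(g_{ij})$ and of $3$-forms $H(t)=(H_{ijk})$, smooth in $(x,t)\in M\times[0,T]$, such that $$\frac{\partial}{\partial t}g_{ij}=-2R_{ij}+\tfrac12\, g^{kp}g^{lq}H_{ikl}H_{jpq},\qquad \frac{\partial}{\partial t}H=\square_{g(x,t)}H\qquad\text{on } M\times[0,T].$$ Here $R_{ij}$ is the Ricci tensor of $g(t)$ (positive on round spheres), and $\square_{g}=-(dd^{*}+d^{*}d)$, where $d$ is the exterior derivative and $d^{*}$ is its formal $L^2$-adjoint with respect to $g$, for the usual inner product $\langle\alpha,\beta\rangle=\frac1{p!}g^{i_1j_1}\cdots g^{i_pj_p}\alpha_{i_1\dots i_p}\beta_{j_1\dots j_p}$ of $p$-forms. The norm of a covariant tensor is given by full contraction, $|A|_g^2=g^{i_1j_1}\cdots g^{i_pj_p}A_{i_1\dots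 i_p}A_{j_1\dots j_p}$, both for the Riemann curvature tensor $\mathrm{Rm}$ of $g(t)$ and for $H$. Let $K_1,K_2\ge 0$ be constants such that $$|\mathrm{Rm}(x,t)|_{g(x,t)}\le K_1\quad\text{and}\quad |H(x,0)|_{g(x,0)}\le K_2\qquad\text{for all }x\in M,\ t\in[0,T].$$ Then $$|H(x,t)|_{g(x,t)}\le K_2\,e^{C_nK_1t}\qquad\text{for all }x\in M,\ t\in[0,T].$$ -/

import Mathlib

open Set MeasureTheory
open scoped Manifold ContDiff

noncomputable section

namespace GRF

/-- The model space `ℝⁿ`. -/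
abbrev Coord (n : ℕ) : Type := EuclideanSpace ℝ (Fin n)

/-- The `i`-th standard basis vector of `ℝⁿ`. -/
def stdVec {n : ℕ} (i : Fin n) : Coord n := EuclideanSpace.single i (1 : ℝ)

/-- The partial derivative `∂ᵢ f`. -/
def pd {n : ℕ} (i : Fin n) (f : Coord n → ℝ) (y : Coord n) : ℝ := fderiv ℝ f y (stdVec i)

/-! ### Riemannian geometry of a metric given in coordinates

Here `G y` is the matrix `(gᵢⱼ(y))`, and `(G y)⁻¹` is the matrix `(gⁱʲ(y))`. -/

/-- The full contraction `⟨T, U⟩ = A^{i₁j₁} ⋯ A^{iₚjₚ} T_{i₁…iₚ} U_{j₁…jₚ}` of two covariant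
`p`-tensors, for the inverse metric `A = (gⁱʲ)`. -/
def tensorInner {n p : ℕ} (A : Matrix (Fin n) (Fin n) ℝ) (T U : (Fin p → Fin n) → ℝ) : ℝ :=
  ∑ I : Fin p → Fin n, ∑ J : Fin p → Fin n, (∏ a, A (I a) (J a)) * T I * U J

/-- The norm `|T| = ⟨T, T⟩^{1/2}` of a covariant `p`-tensor. -/
def tensorNorm {n p : ℕ} (A : Matrix (Fin n) (Fin n) ℝ) (T : (Fin p → Fin n) → ℝ) : ℝ :=
  Real.sqrt (tensorInner A T T)

/-- The Christoffel symbols `Γᵏᵢⱼ = ½ gᵏˡ (∂ᵢ gⱼₗ + ∂ⱼ gᵢₗ - ∂ₗ gᵢⱼ)` of the Levi-Civita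
connection. -/
def christoffel {n : ℕ} (G : Coord n → Matrix (Fin n) (Fin n) ℝ) (k i j : Fin n)
    (y : Coord n) : ℝ :=
  (1 / 2 : ℝ) * ∑ l, (G y)⁻¹ k l *
    (pd i (fun z => G z j l) y + pd j (fun z => G z i l) y - pd l (fun z => G z i j) y)

/-- The `p`-th component of `R(∂ᵢ, ∂ⱼ)∂ₗ = ∇ᵢ∇ⱼ∂ₗ - ∇ⱼ∇ᵢ∂ₗ`. -/
def curvUp {n : ℕ} (G : Coord n → Matrix (Fin n) (Fin n) ℝ) (i j l p : Fin n)
    (y : Coord n) : ℝ :=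
  pd i (christoffel G p j l) y - pd j (christoffel G p i l) y
    + ∑ q, (christoffel G q j l y * christoffel G p i q y
        - christoffel G q i l y * christoffel G p j q y)

/-- The Riemann tensor `Rᵢⱼₖₗ = g(R(∂ᵢ, ∂ⱼ)∂ₗ, ∂ₖ)`; thus `Rᵢⱼᵢⱼ > 0` on round spheres. -/
def riem {n : ℕ} (G : Coord n → Matrix (Fin n) (Fin n) ℝ) (i j k l : Fin n)
    (y : Coord n) : ℝ :=
  ∑ p, G y k p * curvUp G i j l p y

/-- The Ricci tensor `Rᵢⱼ = gᵏˡ Rᵢₖⱼₗ`. -/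
def ricci {n : ℕ} (G : Coord n → Matrix (Fin n) (Fin n) ℝ) (i j : Fin n) (y : Coord n) : ℝ :=
  ∑ k, ∑ l, (G y)⁻¹ k l * riem G i k j l y

/-- The components `β_{i₁…iₚ} = β(∂_{i₁}, …, ∂_{iₚ})` of a `p`-form at a point. -/
def comps {n p : ℕ} (β : Coord n [⋀^Fin p]→L[ℝ] ℝ) (I : Fin p → Fin n) : ℝ :=
  β (fun a => stdVec (I a))

/-- The inner product of `p`-forms, `(1/p!) g^{i₁j₁} ⋯ g^{iₚjₚ} α_{i₁…iₚ} β_{j₁…jₚ}`. -/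
def formInner {n p : ℕ} (A : Matrix (Fin n) (Fin n) ℝ) (α β : Coord n [⋀^Fin p]→L[ℝ] ℝ) : ℝ :=
  (1 / (p.factorial : ℝ)) * tensorInner A (comps α) (comps β)

/-- `η = d*β` on the open set `U ⊆ ℝⁿ` with metric `G`: the smooth `p`-form `η` is the image of the
`(p+1)`-form `β` under the formal adjoint of the exterior derivative `d`, i.e.
`∫ ⟨dα, β⟩ dvol = ∫ ⟨α, η⟩ dvol` for all smooth `p`-forms `α` with compact support in `U`,
where `dvol = √(det g) dy`. -/
def IsCodifferential {n p : ℕ} (G : Coord n → Matrix (Fin n) (Fin n) ℝ) (U : Set (Coord n))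
    (β : Coord n → Coord n [⋀^Fin (p + 1)]→L[ℝ] ℝ) (η : Coord n → Coord n [⋀^Fin p]→L[ℝ] ℝ) :
    Prop :=
  ContDiffOn ℝ ∞ η U ∧
  ∀ α : Coord n → Coord n [⋀^Fin p]→L[ℝ] ℝ,
    ContDiff ℝ ∞ α → HasCompactSupport α → tsupport α ⊆ U →
      ∫ y in U, formInner (G y)⁻¹ (extDeriv α y) (β y) * Real.sqrt (G y).det
        = ∫ y in U, formInner (G y)⁻¹ (α y) (η y) * Real.sqrt (G y).det

/-- `ζ = □β` on the open set `U ⊆ ℝⁿ` with metric `G`, where `□ = -(d d* + d* d)` is the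
Laplace-Beltrami operator on `(p+1)`-forms. -/
def IsLaplaceBeltrami {n p : ℕ} (G : Coord n → Matrix (Fin n) (Fin n) ℝ) (U : Set (Coord n))
    (β ζ : Coord n → Coord n [⋀^Fin (p + 1)]→L[ℝ] ℝ) : Prop :=
  ∃ (η : Coord n → Coord n [⋀^Fin p]→L[ℝ] ℝ) (θ : Coord n → Coord n [⋀^Fin (p + 1)]→L[ℝ] ℝ),
    IsCodifferential G U β η ∧ IsCodifferential G U (extDeriv β) θ ∧
      ∀ y ∈ U, ζ y = -(extDeriv η y + θ y)

/-! ### Metrics and forms on a manifold -/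

section Manifold

/-- The smooth Riemannian metrics on the `n`-manifold `M`. -/
abbrev RiemMetric (n : ℕ) (M : Type*) [TopologicalSpace M] [ChartedSpace (Coord n) M]
    [IsManifold 𝓘(ℝ, Coord n) ∞ M] : Type _ :=
  Bundle.ContMDiffRiemannianMetric 𝓘(ℝ, Coord n) ∞ (Coord n)
    (fun x : M => TangentSpace 𝓘(ℝ, Coord n) x)

/-- The (not necessarily smooth) differential `p`-forms on the `n`-manifold `M`. -/
abbrev DiffForm (n p : ℕ) (M : Type*) [TopologicalSpace M] [ChartedSpace (Coord n) M] : Type _ :=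
  (x : M) → TangentSpace 𝓘(ℝ, Coord n) x [⋀^Fin p]→L[ℝ] ℝ

variable {n : ℕ} {M : Type*} [TopologicalSpace M] [ChartedSpace (Coord n) M]

/-- The differential at `y` of the inverse of the chart `e`; it maps the `i`-th standard basis
vector to the coordinate vector `∂ᵢ` at `e.symm y`. -/
def chartInvDeriv (e : OpenPartialHomeomorph M (Coord n)) (y : Coord n) :
    Coord n →L[ℝ] TangentSpace 𝓘(ℝ, Coord n) (e.symm y) :=
  mfderiv 𝓘(ℝ, Coord n) 𝓘(ℝ, Coord n) e.symm y

/-- The components `gᵢⱼ = g(∂ᵢ, ∂ⱼ)` of a metric in the chart `e`. -/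
def localMetric [IsManifold 𝓘(ℝ, Coord n) ∞ M] (g : RiemMetric n M)
    (e : OpenPartialHomeomorph M (Coord n)) (y : Coord n) : Matrix (Fin n) (Fin n) ℝ :=
  Matrix.of fun i j =>
    g.inner (e.symm y) (chartInvDeriv e y (stdVec i)) (chartInvDeriv e y (stdVec j))

/-- The expression of a `p`-form in the chart `e` (its pullback under `e.symm`). -/
def localForm {p : ℕ} (H : DiffForm n p M) (e : OpenPartialHomeomorph M (Coord n))
    (y : Coord n) : Coord n [⋀^Fin p]→L[ℝ] ℝ :=
  (H (e.symm y)).compContinuousLinearMap (chartInvDeriv e y)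

/-- `|Rm|_g` at the point `x`, computed in the preferred chart at `x` (it does not depend on the
chart). -/
def normRm [IsManifold 𝓘(ℝ, Coord n) ∞ M] (g : RiemMetric n M) (x : M) : ℝ :=
  let e := chartAt (Coord n) x
  tensorNorm (localMetric g e (e x))⁻¹
    (fun I : Fin 4 → Fin n => riem (localMetric g e) (I 0) (I 1) (I 2) (I 3) (e x))

/-- `|H|_g` at the point `x`, with `|H|² = g^{ip} g^{jq} g^{kr} H_{ijk} H_{pqr}` when `H` is a `3`-form,
computed in the preferred chart at `x` (it does not depend on the chart). -/
def normForm [IsManifold 𝓘(ℝ, Coord n) ∞ M] {p : ℕ} (g : RiemMetric n M) (H : DiffForm n p M)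
    (x : M) : ℝ :=
  let e := chartAt (Coord n) x
  tensorNorm (localMetric g e (e x))⁻¹ (comps (localForm H e (e x)))

/-- `(g(t), H(t))`, `0 ≤ t ≤ T`, is a smooth solution of the generalized Ricci flow
`∂ₜ g_{ij} = -2 R_{ij} + ½ g^{kp} g^{lq} H_{ikl} H_{jpq}`, `∂ₜ H = □_{g(t)} H` on `M`. The smoothness in `(x, t)` and
the two equations are expressed in all smooth charts. -/
structure IsSolution [IsManifold 𝓘(ℝ, Coord n) ∞ M] (T : ℝ) (g : ℝ → RiemMetric n M)
    (H : ℝ → DiffForm n 3 M) : Prop where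
  smooth_metric : ∀ e ∈ IsManifold.maximalAtlas 𝓘(ℝ, Coord n) ∞ M, ∀ i j : Fin n,
    ContDiffOn ℝ ∞ (fun z : Coord n × ℝ => localMetric (g z.2) e z.1 i j) (e.target ×ˢ Icc 0 T)
  smooth_form : ∀ e ∈ IsManifold.maximalAtlas 𝓘(ℝ, Coord n) ∞ M,
    ContDiffOn ℝ ∞ (fun z : Coord n × ℝ => localForm (H z.2) e z.1) (e.target ×ˢ Icc 0 T)
  evol_metric : ∀ e ∈ IsManifold.maximalAtlas 𝓘(ℝ, Coord n) ∞ M, ∀ y ∈ e.target,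
    ∀ t ∈ Icc 0 T, ∀ i j : Fin n,
      HasDerivWithinAt (fun s => localMetric (g s) e y i j)
        (-2 * ricci (localMetric (g t) e) i j y
          + (1 / 2 : ℝ) * ∑ k, ∑ l, ∑ p, ∑ q,
              (localMetric (g t) e y)⁻¹ k p * (localMetric (g t) e y)⁻¹ l q
                * comps (localForm (H t) e y) ![i, k, l]
                * comps (localForm (H t) e y) ![j, p, q])
        (Icc 0 T) t
  evol_form : ∀ e ∈ IsManifold.maximalAtlas 𝓘(ℝ, Coord n) ∞ M, ∀ t ∈ Icc 0 T,
    ∃ ζ : Coord n → Coord n [⋀^Fin 3]→L[ℝ] ℝ,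
      IsLaplaceBeltrami (localMetric (g t) e) e.target (localForm (H t) e) ζ ∧
      ∀ y ∈ e.target, HasDerivWithinAt (fun s => localForm (H s) e y) (ζ y) (Icc 0 T) t

end Manifold

end GRF

end

/-! The proof is a maximum principle for `u = |H|²` on the compact space `M × [0, T]`.
Differentiating `u` in time gives `2⟨□H, H⟩` plus a term from the motion of the inverse metric, in
which `-∂ₜg = 2 Ric - ½ H²` acts on `H` as a derivation.

For the first term, the Weitzenböck formula (`IsLaplaceBeltrami.apply_eq`) writes `□H` as the rough
Laplacian of `H` plus a contraction of curvature with `H`. At a spatial maximum of `u` the second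
derivatives of `|H|²` are nonpositive, and the squares `|∇H|²` only help, so the rough Laplacian
contributes nothing positive (`innerForm_hess_nonpos`). The curvature terms are at most a multiple
of `|Rm| |H|²`, by counting components in an orthonormal frame. For the second term, the Ricci part
is bounded in the same way, and the quadratic part `-½ H²` enters with a favourable sign: by
antisymmetry of `H` it is minus a sum of squares (`sum_contract_nonneg`). Hence `∂ₜu ≤ 24 n⁵ K₁ u`
at every spatial maximum. `le_mul_exp_of_deriv_le_at_max` then gives `u ≤ K₂² exp(24 n⁵ K₁ t)`, and
a square root halves the exponent.

Since `d*` is given only as a formal adjoint, it must first be identified. Testing against `ψ γ`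
with `ψ` a bump function and `γ` a constant form, integrating by parts and using the fundamental
lemma of the calculus of variations yields `d*β = -gⁱʲ ∇ᵢβ(∂ⱼ, ·)` (`IsCodifferential.eq_neg_sum`).
All tensor calculus is done in charts; `innerForm_gram_eq` shows that `|H|²` is nevertheless a
well-defined function on `M`. -/

noncomputable section

namespace GRF

/-! ### Torsion-free connections acting on forms over a vector space -/

section Connection

variable {E : Type*} [NormedAddCommGroup E] [NormedSpace ℝ E] {p : ℕ}

open ContinuousAlternatingMap hiding add_apply sub_apply neg_apply

theorem hasFDerivAt_clm_comp {X Y Z : Type*} [NormedAddCommGroup X] [NormedSpace ℝ X]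
    [NormedAddCommGroup Y] [NormedSpace ℝ Y] [NormedAddCommGroup Z] [NormedSpace ℝ Z]
    (L : Y →L[ℝ] Z) {f : X → Y} {f' : X →L[ℝ] Y} {x : X} (hf : HasFDerivAt f f' x) :
    HasFDerivAt (fun z => L (f z)) (L.comp f') x :=
  L.hasFDerivAt.comp x hf

/-- The product rule behind the derivative of `∇β`, with `act` replaced by an arbitrary bilinear
map, since only bilinearity matters. -/
theorem fderiv_sub_bilinear_comp {X F W : Type*} [NormedAddCommGroup X] [NormedSpace ℝ X]
    [NormedAddCommGroup F] [NormedSpace ℝ F] [NormedAddCommGroup W] [NormedSpace ℝ W]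
    (L : F →L[ℝ] W →L[ℝ] F) {β : X → F} {Γ : X → X →L[ℝ] W} {y : X}
    (hΓ : DifferentiableAt ℝ Γ y) (hβ : ContDiffAt ℝ 2 β y) (u v : X) :
    fderiv ℝ (fun z => fderiv ℝ β z - (L (β z)).comp (Γ z)) y u v =
      fderiv ℝ (fderiv ℝ β) y u v - L (fderiv ℝ β y u) (Γ y v) - L (β y) (fderiv ℝ Γ y u v) := by
  have h1 : DifferentiableAt ℝ (fderiv ℝ β) y :=
    (hβ.fderiv_right (m := 1) (by norm_num)).differentiableAt (by norm_num)
  have h2 : DifferentiableAt ℝ β y := hβ.differentiableAt (by norm_num)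
  have h3 : HasFDerivAt (fun z => L (β z)) (L.comp (fderiv ℝ β y)) y :=
    hasFDerivAt_clm_comp L h2.hasFDerivAt
  have h4 : HasFDerivAt (fun z => fderiv ℝ β z - (L (β z)).comp (Γ z)) _ y :=
    h1.hasFDerivAt.sub (h3.clm_comp hΓ.hasFDerivAt)
  rw [h4.fderiv]
  simp
  abel

/-- The action of an endomorphism `M` on a form `β` as a derivation,
`(act β M)(v₁, …, vₚ) = ∑ₐ β(v₁, …, M vₐ, …, vₚ)`. -/
def act : (E [⋀^Fin p]→L[ℝ] ℝ) →L[ℝ] (E →L[ℝ] E) →L[ℝ] (E [⋀^Fin p]→L[ℝ] ℝ) :=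
  fderivCompContinuousLinearMapCLM ℝ (ContinuousLinearMap.id ℝ E)

theorem act_apply (β : E [⋀^Fin p]→L[ℝ] ℝ) (M : E →L[ℝ] E) (v : Fin p → E) :
    act β M v = ∑ a, β (Function.update v a (M (v a))) := by
  simp only [act, fderivCompContinuousLinearMapCLM_apply, fderivCompContinuousLinearMap_apply]
  refine Finset.sum_congr rfl fun a _ => congrArg _ (funext fun j => ?_)
  rcases eq_or_ne j a with rfl | h
  · simp
  · simp [h]

/-- The derivation acts on the first slot as well as on the others; contraction with `w` removes
that first-slot term. -/
theorem act_curryLeft (β : E [⋀^Fin (p + 1)]→L[ℝ] ℝ) (M : E →L[ℝ] E) (w : E) :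
    act (β.curryLeft w) M = (act β M).curryLeft w - β.curryLeft (M w) := by
  ext v
  simp only [act_apply, ContinuousAlternatingMap.sub_apply, curryLeft_apply_apply, Matrix.vecCons]
  rw [Fin.sum_univ_succ]
  simp only [Fin.cons_zero, Fin.update_cons_zero, Fin.cons_succ, ← Fin.cons_update]
  ring

theorem act_alternatizeUncurryFin (φ : E →L[ℝ] E [⋀^Fin p]→L[ℝ] ℝ) (M : E →L[ℝ] E) :
    act (alternatizeUncurryFin φ) M
      = alternatizeUncurryFin ((act.flip M).comp φ + φ.comp M) := by
  ext v
  simp only [act_apply, alternatizeUncurryFin_apply, _root_.add_apply,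
    ContinuousLinearMap.comp_apply, ContinuousLinearMap.flip_apply]
  rw [Finset.sum_comm]
  refine Finset.sum_congr rfl fun b _ => ?_
  -- When the modified slot is the slot `b` fed to `φ`, the result is `φ.comp M`; the other slots
  -- make up the action on the values of `φ`.
  rw [Fin.sum_univ_succAbove _ b, Fin.removeNth_update, Function.update_self, add_comm,
    ContinuousAlternatingMap.add_apply, act_apply, smul_add, Finset.smul_sum]
  congr 1
  refine Finset.sum_congr rfl fun c _ => ?_
  rw [Function.update_of_ne (Fin.succAbove_ne b c).symm, Fin.removeNth_update_succAbove]
  rfl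

/-- Terms in which `M` and `N` hit different slots are symmetric in the two operators and cancel;
only the compositions within one slot survive. The order is reversed because operators act on the
arguments of `β`. -/
theorem act_act_sub (β : E [⋀^Fin p]→L[ℝ] ℝ) (M N : E →L[ℝ] E) :
    act (act β N) M - act (act β M) N = act β (N.comp M - M.comp N) := by
  have key : ∀ (M N : E →L[ℝ] E) (v : Fin p → E), act (act β N) M v =
      act β (N.comp M) v + ∑ a, ∑ b, if b = a then 0 else
        β (Function.update (Function.update v a (M (v a))) b (N (v b))) := by
    intro M N v
    simp only [act_apply, ← Finset.sum_add_distrib]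
    refine Finset.sum_congr rfl fun a _ => ?_
    rw [← Finset.add_sum_erase _ _ (Finset.mem_univ a),
      ← Finset.add_sum_erase (a := a) (f := fun b => if b = a then (0 : ℝ) else _) _
        (Finset.mem_univ a)]
    simp only [Function.update_self, Function.update_idem, if_true, zero_add,
      ContinuousLinearMap.comp_apply]
    congr 1
    refine Finset.sum_congr rfl fun b hb => ?_
    have hb' := Finset.ne_of_mem_erase hb
    rw [if_neg hb', Function.update_of_ne hb']
  ext v
  rw [ContinuousAlternatingMap.sub_apply, key, key, map_sub, ContinuousAlternatingMap.sub_apply]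
  have : ∀ a b : Fin p, (if a = b then (0 : ℝ) else
      β (Function.update (Function.update v b (N (v b))) a (M (v a)))) =
      if b = a then 0 else β (Function.update (Function.update v a (M (v a))) b (N (v b))) := by
    intro a b
    by_cases h : a = b
    · simp [h]
    · rw [if_neg h, if_neg (Ne.symm h), Function.update_comm h]
  rw [Finset.sum_comm (f := fun a b => if b = a then (0 : ℝ) else
      β (Function.update (Function.update v a (N (v a))) b (M (v b))))]
  simp only [this]
  ring

/-- `(curryLeft of the alternatization)`: the contraction of an alternatized form. -/
theorem curryLeft_alternatizeUncurryFin (φ : E →L[ℝ] E [⋀^Fin (p + 1)]→L[ℝ] ℝ) (w : E) :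
    (alternatizeUncurryFin φ).curryLeft w =
      φ w - alternatizeUncurryFin (((curryLeftLI (𝕜 := ℝ) (E := E)
        (F := ℝ) (n := p)).toContinuousLinearMap.flip w).comp φ) := by
  ext v
  have h0 : (Matrix.vecCons w v : Fin (p + 2) → E) 0 = w := rfl
  have h1 : Fin.removeNth 0 (Matrix.vecCons w v : Fin (p + 2) → E) = v := rfl
  have h2 : ∀ i : Fin (p + 1), Fin.removeNth i.succ (Matrix.vecCons w v : Fin (p + 2) → E)
      = Matrix.vecCons w (Fin.removeNth i v) := by
    intro i
    funext j
    refine Fin.cases ?_ (fun k => ?_) j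
    · simp [Fin.removeNth_apply]
    · simp [Fin.removeNth_apply, Fin.succ_succAbove_succ]
  rw [curryLeft_apply_apply, ContinuousAlternatingMap.sub_apply, alternatizeUncurryFin_apply,
    alternatizeUncurryFin_apply, Fin.sum_univ_succ, sub_eq_add_neg, ← Finset.sum_neg_distrib]
  congr 1
  · rw [h0, h1]
    simp
  · refine Finset.sum_congr rfl fun i _ => ?_
    rw [h2, Matrix.cons_val_succ, Fin.val_succ, pow_succ, mul_neg_one, neg_smul]
    rfl

variable (Γ : E → E →L[ℝ] E →L[ℝ] E)

/-- The covariant derivative `v ↦ ∇ᵥβ` of a form for the connection with Christoffel map `Γ`. -/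
def nabla (β : E → E [⋀^Fin p]→L[ℝ] ℝ) (y : E) : E →L[ℝ] E [⋀^Fin p]→L[ℝ] ℝ :=
  fderiv ℝ β y - (act (β y)).comp (Γ y)

/-- The second covariant derivative `(u, v) ↦ ∇²ᵤᵥβ` of a form. -/
def hess (β : E → E [⋀^Fin p]→L[ℝ] ℝ) (y u : E) : E →L[ℝ] E [⋀^Fin p]→L[ℝ] ℝ :=
  fderiv ℝ (nabla Γ β) y u - (act.flip (Γ y u)).comp (nabla Γ β y) - (nabla Γ β y).comp (Γ y u)

/-- The curvature operator `R(u, v)` of the connection `Γ`. -/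
def curvOp (y u v : E) : E →L[ℝ] E :=
  fderiv ℝ Γ y u v - fderiv ℝ Γ y v u + (Γ y u).comp (Γ y v) - (Γ y v).comp (Γ y u)

variable {Γ} {β : E → E [⋀^Fin p]→L[ℝ] ℝ} {y : E}

theorem nabla_apply (v : E) : nabla Γ β y v = fderiv ℝ β y v - act (β y) (Γ y v) := rfl

theorem hess_apply (u v : E) : hess Γ β y u v =
    fderiv ℝ (nabla Γ β) y u v - act (nabla Γ β y v) (Γ y u) - nabla Γ β y (Γ y u v) := rfl

/-- Absence of torsion: the correction `β(…, Γ(u, v), …)` is symmetric in two arguments, so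
alternation kills it and `d` may be computed with `∇`. -/
theorem extDeriv_eq_alternatize_nabla (hΓ : ∀ u v, Γ y u v = Γ y v u) :
    extDeriv β y = alternatizeUncurryFin (nabla Γ β y) := by
  have h := alternatizeUncurryFin_fderivCompContinuousLinearMap_eq_zero (β y)
    (ContinuousLinearMap.id ℝ E) (h := Γ y) hΓ
  have h2 : nabla Γ β y + (act (β y)).comp (Γ y) = fderiv ℝ β y := by
    rw [nabla]
    exact sub_add_cancel (fderiv ℝ β y) _
  rw [extDeriv, ← h2, alternatizeUncurryFin_add]
  change _ + alternatizeUncurryFin ((fderivCompContinuousLinearMap (β y) _).comp (Γ y)) = _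
  rw [h, add_zero]

theorem contDiffAt_nabla {m : ℕ∞} (hΓ : ContDiffAt ℝ m Γ y) (hβ : ContDiffAt ℝ (m + 1) β y) :
    ContDiffAt ℝ m (nabla Γ β) y := by
  have h1 : ContDiffAt ℝ m (fderiv ℝ β) y := hβ.fderiv_right le_rfl
  have h2 : ContDiffAt ℝ m β y := hβ.of_le (by exact_mod_cast le_self_add)
  have hA : ContDiffAt ℝ m (fun z => act (β z)) y :=
    ContDiffAt.comp (g := (act : (E [⋀^Fin p]→L[ℝ] ℝ) →L[ℝ] _)) (f := β) y
      (ContinuousLinearMap.contDiff _).contDiffAt h2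
  exact h1.sub (hA.clm_comp hΓ)

theorem fderiv_nabla_apply (hΓ : DifferentiableAt ℝ Γ y) (hβ : ContDiffAt ℝ 2 β y) (u v : E) :
    fderiv ℝ (nabla Γ β) y u v = fderiv ℝ (fderiv ℝ β) y u v
      - act (fderiv ℝ β y u) (Γ y v) - act (β y) (fderiv ℝ Γ y u v) :=
  fderiv_sub_bilinear_comp (X := E) (F := E [⋀^Fin p]→L[ℝ] ℝ) (W := E →L[ℝ] E) act hΓ hβ u v

/-- The Ricci identity. Ordinary second derivatives and `∇β(Γ(u, v))` cancel by symmetry, and the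
terms quadratic in `Γ` combine through `act_act_sub` into the commutator part of the curvature. -/
theorem hess_sub_hess (hΓs : ∀ u v, Γ y u v = Γ y v u) (hΓ : DifferentiableAt ℝ Γ y)
    (hβ : ContDiffAt ℝ 2 β y) (u v : E) :
    hess Γ β y u v - hess Γ β y v u = - act (β y) (curvOp Γ y u v) := by
  have hs : fderiv ℝ (fderiv ℝ β) y u v = fderiv ℝ (fderiv ℝ β) y v u :=
    (hβ.isSymmSndFDerivAt (by simp)).eq u v
  have hb := act_act_sub (β y) (Γ y u) (Γ y v)
  simp only [hess_apply, fderiv_nabla_apply hΓ hβ, nabla_apply, curvOp, map_sub, map_add, hs,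
    hΓs v u, _root_.sub_apply] at hb ⊢
  rw [eq_sub_iff_add_eq] at hb
  rw [← hb]
  abel

/-- Covariant derivative of a contraction against a vector field. -/
theorem nabla_curryLeft {β : E → E [⋀^Fin (p + 1)]→L[ℝ] ℝ} {w : E → E} {w' : E →L[ℝ] E}
    (hβ : DifferentiableAt ℝ β y) (hw : HasFDerivAt w w' y) (v : E) :
    nabla Γ (fun z => (β z).curryLeft (w z)) y v =
      (nabla Γ β y v).curryLeft (w y) + (β y).curryLeft (w' v + Γ y v (w y)) := by
  have h1 := hasFDerivAt_clm_comp (X := E) (Y := E [⋀^Fin (p + 1)]→L[ℝ] ℝ)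
    (Z := E →L[ℝ] E [⋀^Fin p]→L[ℝ] ℝ) (curryLeftLI (𝕜 := ℝ) (E := E) (F := ℝ) (n := p)).toContinuousLinearMap hβ.hasFDerivAt
  have := (h1.clm_apply hw).fderiv
  rw [nabla_apply]
  refine (congrArg (fun φ : E →L[ℝ] E [⋀^Fin p]→L[ℝ] ℝ => φ v - _) this).trans ?_
  rw [act_curryLeft, nabla_apply]
  ext x
  simp
  ring

/-- Covariant derivative of the exterior derivative. -/
theorem nabla_extDeriv (hΓs : ∀ᶠ z in nhds y, ∀ u v, Γ z u v = Γ z v u)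
    (hΓ : ContDiffAt ℝ 1 Γ y) (hβ : ContDiffAt ℝ 2 β y) (u : E) :
    nabla Γ (extDeriv β) y u = alternatizeUncurryFin (hess Γ β y u) := by
  have h1 : extDeriv β =ᶠ[nhds y] fun z => alternatizeUncurryFin (nabla Γ β z) :=
    hΓs.mono fun z hz => extDeriv_eq_alternatize_nabla hz
  have h2 : DifferentiableAt ℝ (nabla Γ β) y :=
    (contDiffAt_nabla (m := 1) (by exact_mod_cast hΓ) (by norm_num; exact hβ)).differentiableAt (by norm_num)
  have h3 := (hasFDerivAt_clm_comp (X := E) (Y := E →L[ℝ] E [⋀^Fin p]→L[ℝ] ℝ)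
    (Z := E [⋀^Fin (p + 1)]→L[ℝ] ℝ) (alternatizeUncurryFinCLM ℝ E ℝ) h2.hasFDerivAt).fderiv
  simp only [alternatizeUncurryFinCLM_apply] at h3
  rw [nabla_apply, h1.fderiv_eq, h1.self_of_nhds, h3, act_alternatizeUncurryFin, hess,
    ← alternatizeUncurryFinCLM_apply, ← alternatizeUncurryFinCLM_apply, map_add, map_sub, map_sub]
  simp only [ContinuousLinearMap.comp_apply, alternatizeUncurryFinCLM_apply]
  abel

end Connection

/-! ### Matrices as operators: calculus of inverses and determinants -/

section Operators

variable {n : ℕ}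

/-- The endomorphism of `ℝⁿ` with a given matrix. -/
def toOp (m : Matrix (Fin n) (Fin n) ℝ) : Coord n →L[ℝ] Coord n :=
  Matrix.toEuclideanCLM (n := Fin n) (𝕜 := ℝ) m

theorem sum_smul_stdVec (v : Coord n) : ∑ i, v i • stdVec i = v := by
  ext j
  simp [stdVec, Pi.single_apply]

theorem stdVec_apply (i j : Fin n) : (stdVec i : Coord n) j = if j = i then 1 else 0 := by
  simp [stdVec]

theorem toOp_apply (m : Matrix (Fin n) (Fin n) ℝ) (v : Coord n) (i : Fin n) :
    toOp m v i = ∑ j, m i j * v j := rfl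

theorem toOp_stdVec (m : Matrix (Fin n) (Fin n) ℝ) (j : Fin n) :
    toOp m (stdVec j) = ∑ i, m i j • stdVec i := by
  ext i
  simp [toOp_apply, stdVec_apply]

theorem toOp_mul (a b : Matrix (Fin n) (Fin n) ℝ) : toOp (a * b) = (toOp a).comp (toOp b) :=
  map_mul (Matrix.toEuclideanCLM (n := Fin n) (𝕜 := ℝ)) a b

theorem toOp_add (a b : Matrix (Fin n) (Fin n) ℝ) : toOp (a + b) = toOp a + toOp b :=
  map_add (Matrix.toEuclideanCLM (n := Fin n) (𝕜 := ℝ)) a b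

theorem toOp_one : toOp (1 : Matrix (Fin n) (Fin n) ℝ) = ContinuousLinearMap.id ℝ _ :=
  map_one (Matrix.toEuclideanCLM (n := Fin n) (𝕜 := ℝ))

theorem toOp_transpose (m : Matrix (Fin n) (Fin n) ℝ) :
    toOp m.transpose = ContinuousLinearMap.adjoint (toOp m) := by
  have := map_star (Matrix.toEuclideanCLM (n := Fin n) (𝕜 := ℝ)) m
  rwa [Matrix.star_eq_conjTranspose, Matrix.conjTranspose_eq_transpose_of_trivial,
    ContinuousLinearMap.star_eq_adjoint] at this

/-- Both inverses are zero off the units, so no invertibility is needed; this gives access to the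
smoothness of `Ring.inverse` in a Banach algebra. -/
theorem toOp_inv (m : Matrix (Fin n) (Fin n) ℝ) : toOp m⁻¹ = Ring.inverse (toOp m) := by
  rw [Matrix.nonsing_inv_eq_ringInverse]
  by_cases h : IsUnit m
  · obtain ⟨u, rfl⟩ := h
    have h := Ring.inverse_unit (Units.map
      (Matrix.toEuclideanCLM (n := Fin n) (𝕜 := ℝ)).toRingEquiv.toRingHom.toMonoidHom u)
    rw [Ring.inverse_unit]
    exact h.symm
  · rw [Ring.inverse_non_unit _ h, Ring.inverse_non_unit]
    · exact map_zero (Matrix.toEuclideanCLM (n := Fin n) (𝕜 := ℝ))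
    · intro h'
      exact h ((MulEquiv.isUnit_map (Matrix.toEuclideanCLM (n := Fin n) (𝕜 := ℝ))).1 h')

theorem toOp_eq_sum (m : Matrix (Fin n) (Fin n) ℝ) :
    toOp m = ∑ i, ∑ j, m i j • toOp (Matrix.single i j 1) := by
  have h : ∀ i j, m i j • toOp (Matrix.single i j 1) = toOp (Matrix.single i j (m i j)) := by
    intro i j
    rw [← mul_one (m i j), ← smul_eq_mul, ← Matrix.smul_single, smul_eq_mul, mul_one]
    exact (map_smul (Matrix.toEuclideanCLM (n := Fin n) (𝕜 := ℝ)) _ _).symm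
  simp_rw [h]
  conv_lhs => rw [Matrix.matrix_eq_sum_single m]
  simp only [toOp, map_sum]

section Deriv

variable {X : Type*} [NormedAddCommGroup X] [NormedSpace ℝ X] {s : Set X} {x : X}
  {G : X → Matrix (Fin n) (Fin n) ℝ}

theorem contDiffOn_toOp {N : WithTop ℕ∞} (hG : ∀ i j, ContDiffOn ℝ N (fun z => G z i j) s) :
    ContDiffOn ℝ N (fun z => toOp (G z)) s := by
  have : (fun z => toOp (G z)) =
      fun z => ∑ i, ∑ j, G z i j • toOp (Matrix.single i j 1) := by
    funext z
    exact toOp_eq_sum _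
  rw [this]
  exact ContDiffOn.sum fun i _ => ContDiffOn.sum fun j _ => (hG i j).smul contDiffOn_const

theorem hasFDerivWithinAt_toOp {G' : Fin n → Fin n → X →L[ℝ] ℝ}
    (hG : ∀ i j, HasFDerivWithinAt (fun z => G z i j) (G' i j) s x) :
    HasFDerivWithinAt (fun z => toOp (G z))
      (∑ i, ∑ j, (G' i j).smulRight (toOp (Matrix.single i j 1))) s x := by
  have : (fun z => toOp (G z)) =
      fun z => ∑ i, ∑ j, G z i j • toOp (Matrix.single i j 1) := by
    funext z
    exact toOp_eq_sum _
  rw [this]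
  exact HasFDerivWithinAt.fun_sum fun i _ => HasFDerivWithinAt.fun_sum fun j _ =>
    HasFDerivWithinAt.smul_const (F := Coord n →L[ℝ] Coord n) (hG i j) _

theorem sum_smulRight_toOp_apply (G' : Fin n → Fin n → X →L[ℝ] ℝ) (v : X) :
    (∑ i, ∑ j, (G' i j).smulRight (toOp (Matrix.single i j (1 : ℝ)))) v =
      toOp (Matrix.of fun i j => G' i j v) := by
  rw [toOp_eq_sum]
  simp

theorem contDiffOn_toOp_inv {N : WithTop ℕ∞} (hG : ∀ i j, ContDiffOn ℝ N (fun z => G z i j) s)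
    (hu : ∀ z ∈ s, IsUnit (G z)) :
    ContDiffOn ℝ N (fun z => toOp (G z)⁻¹) s := by
  intro z hz
  simp only [toOp_inv]
  obtain ⟨u, hu'⟩ := (hu z hz).map (Matrix.toEuclideanCLM (n := Fin n) (𝕜 := ℝ))
  have h1 : ContDiffAt ℝ N Ring.inverse (toOp (G z)) := by
    have := contDiffAt_ringInverse ℝ (n := N) u
    rwa [hu'] at this
  exact h1.comp_contDiffWithinAt z (contDiffOn_toOp hG z hz)

theorem hasFDerivWithinAt_ringInverse_comp {R : Type*} [NormedRing R] [NormedAlgebra ℝ R]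
    [HasSummableGeomSeries R] {f : X → R} {L : X →L[ℝ] R} (hf : HasFDerivWithinAt f L s x)
    (hu : IsUnit (f x)) :
    ∃ L' : X →L[ℝ] R, HasFDerivWithinAt (fun z => Ring.inverse (f z)) L' s x ∧
      ∀ v, L' v = -(Ring.inverse (f x) * L v * Ring.inverse (f x)) := by
  obtain ⟨u, hu'⟩ := hu
  have h1 := hasFDerivAt_ringInverse (𝕜 := ℝ) u
  rw [hu'] at h1
  refine ⟨_, h1.comp_hasFDerivWithinAt x hf, fun v => ?_⟩
  rw [← hu', Ring.inverse_unit]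
  simp

theorem hasFDerivWithinAt_toOp_inv {L : X →L[ℝ] Coord n →L[ℝ] Coord n}
    (hG : HasFDerivWithinAt (fun z => toOp (G z)) L s x) (hu : IsUnit (G x)) :
    ∃ L' : X →L[ℝ] Coord n →L[ℝ] Coord n, HasFDerivWithinAt (fun z => toOp (G z)⁻¹) L' s x ∧
      ∀ v, L' v = -((toOp (G x)⁻¹).comp ((L v).comp (toOp (G x)⁻¹))) := by
  simp only [toOp_inv]
  exact hasFDerivWithinAt_ringInverse_comp (R := Coord n →L[ℝ] Coord n) hG
    (hu.map (Matrix.toEuclideanCLM (n := Fin n) (𝕜 := ℝ)))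

theorem hasFDerivWithinAt_det {G' : Fin n → Fin n → X →L[ℝ] ℝ}
    (hG : ∀ i j, HasFDerivWithinAt (fun z => G z i j) (G' i j) s x) :
    HasFDerivWithinAt (fun z => (G z).det)
      (∑ σ : Equiv.Perm (Fin n), (Equiv.Perm.sign σ : ℤ) • ∑ i,
        (∏ j ∈ Finset.univ.erase i, G x (σ j) j) • G' (σ i) i) s x := by
  simp only [Matrix.det_apply, Units.smul_def]
  exact HasFDerivWithinAt.fun_sum fun σ _ => (HasFDerivWithinAt.finsetProd fun i _ => hG (σ i) i).const_smul
    ((Equiv.Perm.sign σ : ℤ))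

/-- Jacobi's formula: replacing one column at a time in the Leibniz expansion is Cramer's rule,
hence a trace against the adjugate. -/
theorem sum_det_deriv (m : Matrix (Fin n) (Fin n) ℝ) (m' : Fin n → Fin n → X →L[ℝ] ℝ) (v : X) :
    (∑ σ : Equiv.Perm (Fin n), (Equiv.Perm.sign σ : ℤ) • ∑ i,
        (∏ j ∈ Finset.univ.erase i, m (σ j) j) • m' (σ i) i) v
      = (m.adjugate * Matrix.of fun i j => m' i j v).trace := by
  have h : ∀ i, (m.adjugate * Matrix.of fun i j => m' i j v) i i
      = (m.updateCol i fun k => m' k i v).det := by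
    intro i
    rw [← Matrix.cramer_apply, Matrix.cramer_eq_adjugate_mulVec]
    rfl
  simp only [Matrix.trace, Matrix.diag_apply, h, Matrix.det_apply]
  rw [Finset.sum_comm]
  simp only [sum_apply, smul_apply, Units.smul_def,
    Finset.smul_sum]
  refine Finset.sum_congr rfl fun σ _ => Finset.sum_congr rfl fun i _ => ?_
  rw [← Finset.mul_prod_erase _ _ (Finset.mem_univ i), Matrix.updateCol_self]
  congr 1
  rw [smul_eq_mul, mul_comm]
  congr 1
  refine Finset.prod_congr rfl fun j hj => ?_
  rw [Matrix.updateCol_ne (Finset.ne_of_mem_erase hj)]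

theorem contDiffOn_det {N : WithTop ℕ∞} (hG : ∀ i j, ContDiffOn ℝ N (fun z => G z i j) s) :
    ContDiffOn ℝ N (fun z => (G z).det) s := by
  simp only [Matrix.det_apply, Units.smul_def]
  exact ContDiffOn.sum fun σ _ => (contDiffOn_prod fun i _ => hG (σ i) i).const_smul _

end Deriv

end Operators

/-! ### The Levi-Civita connection of a metric on an open set -/

section LocalMetric

variable {n : ℕ}

/-- `G` is a smooth Riemannian metric on the open set `U ⊆ ℝⁿ`. -/
structure MetricOn (G : Coord n → Matrix (Fin n) (Fin n) ℝ) (U : Set (Coord n)) : Prop where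
  isOpen : IsOpen U
  smooth : ∀ i j, ContDiffOn ℝ ∞ (fun y => G y i j) U
  posDef : ∀ y ∈ U, (G y).PosDef

/-- The matrix `(Γᵏᵢⱼ)ₖⱼ` of the Levi-Civita connection in the direction `∂ᵢ`. -/
def christoffelMatrix (G : Coord n → Matrix (Fin n) (Fin n) ℝ) (i : Fin n) (y : Coord n) :
    Matrix (Fin n) (Fin n) ℝ :=
  Matrix.of fun k j => christoffel G k i j y

/-- The Christoffel map `(v, w) ↦ Γ(v, w)`. -/
def gam (G : Coord n → Matrix (Fin n) (Fin n) ℝ) (y : Coord n) :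
    Coord n →L[ℝ] Coord n →L[ℝ] Coord n :=
  ∑ i, (EuclideanSpace.proj i : Coord n →L[ℝ] ℝ).smulRight (toOp (christoffelMatrix G i y))

theorem gam_apply (G : Coord n → Matrix (Fin n) (Fin n) ℝ) (y v : Coord n) :
    gam G y v = ∑ i, v i • toOp (christoffelMatrix G i y) := by
  simp [gam]

theorem gam_stdVec (G : Coord n → Matrix (Fin n) (Fin n) ℝ) (y : Coord n) (i : Fin n) :
    gam G y (stdVec i) = toOp (christoffelMatrix G i y) := by
  rw [gam_apply, Finset.sum_eq_single i]
  · rw [stdVec_apply, if_pos rfl]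
    exact one_smul ℝ _
  · intro j _ h
    rw [stdVec_apply, if_neg h]
    exact zero_smul ℝ (toOp (christoffelMatrix G j y))
  · simp

theorem gam_stdVec_stdVec (G : Coord n → Matrix (Fin n) (Fin n) ℝ) (y : Coord n) (i j : Fin n) :
    gam G y (stdVec i) (stdVec j) = ∑ k, christoffel G k i j y • stdVec k := by
  rw [gam_stdVec, toOp_stdVec]
  rfl

variable {G : Coord n → Matrix (Fin n) (Fin n) ℝ} {U : Set (Coord n)} {y : Coord n}

namespace MetricOn

variable (hG : MetricOn G U)
include hG

theorem isUnit (hy : y ∈ U) : IsUnit (G y) := (hG.posDef y hy).isUnit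

theorem isUnit_det (hy : y ∈ U) : IsUnit (G y).det :=
  (Matrix.isUnit_iff_isUnit_det _).1 (hG.isUnit hy)

theorem symm (hy : y ∈ U) (i j : Fin n) : G y i j = G y j i := by
  have := (hG.posDef y hy).1.apply i j
  simpa using this.symm

theorem transpose_inv (hy : y ∈ U) : ((G y)⁻¹).transpose = (G y)⁻¹ := by
  rw [Matrix.transpose_nonsing_inv]
  congr 1
  ext i j
  exact hG.symm hy j i

theorem pd_symm (hy : y ∈ U) (l i j : Fin n) :
    pd l (fun z => G z i j) y = pd l (fun z => G z j i) y := by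
  have : (fun z => G z i j) =ᶠ[nhds y] fun z => G z j i :=
    (hG.isOpen.mem_nhds hy |> Filter.eventually_of_mem) fun z hz => hG.symm hz i j
  rw [pd, pd, this.fderiv_eq]

theorem christoffel_symm (hy : y ∈ U) (k i j : Fin n) :
    christoffel G k i j y = christoffel G k j i y := by
  unfold christoffel
  congr 1
  refine Finset.sum_congr rfl fun l _ => ?_
  rw [hG.pd_symm hy l i j]
  ring

theorem gam_symm (hy : y ∈ U) (u v : Coord n) : gam G y u v = gam G y v u := by
  have key : ∀ u v : Coord n, gam G y u v =
      ∑ i, ∑ j, (u i * v j) • ∑ k, christoffel G k i j y • stdVec k := by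
    intro u v
    rw [gam_apply]
    simp only [sum_apply, smul_apply]
    refine Finset.sum_congr rfl fun i _ => ?_
    conv_lhs => rw [← sum_smul_stdVec v]
    simp only [map_sum, map_smul, Finset.smul_sum, ← gam_stdVec, gam_stdVec_stdVec, smul_smul,
      mul_assoc]
  rw [key, key, Finset.sum_comm]
  refine Finset.sum_congr rfl fun i _ => Finset.sum_congr rfl fun j _ => ?_
  simp only [hG.christoffel_symm hy _ i j, mul_comm]

theorem sum_metric_christoffel (hy : y ∈ U) (k i j : Fin n) :
    ∑ q, G y k q * christoffel G q i j y = (1 / 2 : ℝ) *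
      (pd i (fun z => G z j k) y + pd j (fun z => G z i k) y - pd k (fun z => G z i j) y) := by
  unfold christoffel
  set c : Fin n → ℝ := fun l =>
    pd i (fun z => G z j l) y + pd j (fun z => G z i l) y - pd l (fun z => G z i j) y with hc
  have h := congrFun (congrArg (fun m => Matrix.mulVec m c)
    (Matrix.mul_nonsing_inv (G y) (hG.isUnit_det hy))) k
  simp only [Matrix.one_mulVec, ← Matrix.mulVec_mulVec] at h
  change _ = (1 / 2 : ℝ) * c k
  rw [← h]
  simp only [Matrix.mulVec, dotProduct, Finset.mul_sum]
  refine Finset.sum_congr rfl fun q _ => Finset.sum_congr rfl fun l _ => ?_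
  ring

/-- Metric compatibility of the Levi-Civita connection in coordinates. -/
theorem pd_metric (hy : y ∈ U) (i j k : Fin n) : pd i (fun z => G z j k) y =
    ((christoffelMatrix G i y).transpose * G y + G y * christoffelMatrix G i y) j k := by
  have h1 := hG.sum_metric_christoffel hy j i k
  have h2 := hG.sum_metric_christoffel hy k i j
  simp only [Matrix.add_apply, Matrix.mul_apply, Matrix.transpose_apply, christoffelMatrix,
    Matrix.of_apply]
  have h3 : ∑ q, christoffel G q i j y * G y q k = ∑ q, G y k q * christoffel G q i j y :=
    Finset.sum_congr rfl fun q _ => by rw [hG.symm hy q k, mul_comm]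
  rw [h3, h1, h2, hG.pd_symm hy i k j, hG.pd_symm hy k i j, hG.pd_symm hy k j i,
    hG.pd_symm hy j i k]
  ring

theorem hasFDerivAt (hy : y ∈ U) (i j : Fin n) :
    HasFDerivAt (fun z => G z i j) (fderiv ℝ (fun z => G z i j) y) y :=
  (((hG.smooth i j).contDiffAt (hG.isOpen.mem_nhds hy)).differentiableAt (by simp)).hasFDerivAt

theorem fderiv_entry (hy : y ∈ U) (v : Coord n) :
    (Matrix.of fun i j => fderiv ℝ (fun z => G z i j) y v) =
    ∑ i, v i • ((christoffelMatrix G i y).transpose * G y + G y * christoffelMatrix G i y) := by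
  ext j k
  rw [Matrix.sum_apply, Matrix.of_apply]
  conv_lhs => rw [← sum_smul_stdVec v]
  simp only [map_sum, map_smul, Matrix.smul_apply, ← hG.pd_metric hy]
  rfl

/-- This is `∇g = 0` in operator form; the adjoint is the Euclidean one, that is, the matrix
transpose. -/
theorem hasFDerivAt_toOp (hy : y ∈ U) : ∃ L : Coord n →L[ℝ] Coord n →L[ℝ] Coord n,
    HasFDerivAt (fun z => toOp (G z)) L y ∧
    ∀ v, L v = (ContinuousLinearMap.adjoint (gam G y v)).comp (toOp (G y)) +
      (toOp (G y)).comp (gam G y v) := by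
  refine ⟨_, (hasFDerivWithinAt_toOp (s := univ)
    fun i j => (hG.hasFDerivAt hy i j).hasFDerivWithinAt).hasFDerivAt_of_univ, fun v => ?_⟩
  rw [sum_smulRight_toOp_apply, hG.fderiv_entry hy, gam_apply]
  have hs : ∀ (f : Fin n → Matrix (Fin n) (Fin n) ℝ), toOp (∑ i, f i) = ∑ i, toOp (f i) :=
    fun f => map_sum (Matrix.toEuclideanCLM (n := Fin n) (𝕜 := ℝ)) f _
  have hm : ∀ (c : ℝ) (f : Matrix (Fin n) (Fin n) ℝ), toOp (c • f) = c • toOp f :=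
    fun c f => map_smul (Matrix.toEuclideanCLM (n := Fin n) (𝕜 := ℝ)) c f
  rw [hs, map_sum]
  ext x : 1
  simp [hm, toOp_add, toOp_mul, toOp_transpose, Finset.sum_add_distrib]

theorem toOp_inv_comp (hy : y ∈ U) : (toOp (G y)⁻¹).comp (toOp (G y)) = .id ℝ _ := by
  rw [← toOp_mul, Matrix.nonsing_inv_mul _ (hG.isUnit_det hy), toOp_one]

theorem toOp_comp_inv (hy : y ∈ U) : (toOp (G y)).comp (toOp (G y)⁻¹) = .id ℝ _ := by
  rw [← toOp_mul, Matrix.mul_nonsing_inv _ (hG.isUnit_det hy), toOp_one]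

theorem hasFDerivAt_toOp_inv (hy : y ∈ U) : ∃ L : Coord n →L[ℝ] Coord n →L[ℝ] Coord n,
    HasFDerivAt (fun z => toOp (G z)⁻¹) L y ∧
    ∀ v, L v = -((toOp (G y)⁻¹).comp (ContinuousLinearMap.adjoint (gam G y v))) -
      (gam G y v).comp (toOp (G y)⁻¹) := by
  obtain ⟨L, hL, hLv⟩ := hG.hasFDerivAt_toOp hy
  obtain ⟨L', hL', hLv'⟩ := hasFDerivWithinAt_toOp_inv (s := univ) hL.hasFDerivWithinAt
    (hG.isUnit hy)
  refine ⟨L', hL'.hasFDerivAt_of_univ, fun v => ?_⟩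
  rw [hLv', hLv]
  have h1 := fun x => DFunLike.congr_fun (hG.toOp_inv_comp hy) x
  have h2 := fun x => DFunLike.congr_fun (hG.toOp_comp_inv hy) x
  simp only [ContinuousLinearMap.comp_apply, ContinuousLinearMap.id_apply] at h1 h2
  ext x : 1
  simp only [neg_apply, ContinuousLinearMap.comp_apply, add_apply, sub_apply, map_add, h1, h2]
  abel

theorem contDiffOn_toOp_inv : ContDiffOn ℝ ∞ (fun z => toOp (G z)⁻¹) U :=
  GRF.contDiffOn_toOp_inv hG.smooth fun _ hz => hG.isUnit hz

theorem contDiffOn_inv (i j : Fin n) : ContDiffOn ℝ ∞ (fun z => (G z)⁻¹ i j) U := by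
  have h : (fun z => (G z)⁻¹ i j) =
      fun z => (EuclideanSpace.proj i : Coord n →L[ℝ] ℝ) (toOp (G z)⁻¹ (stdVec j)) := by
    funext z
    simp [toOp_apply, stdVec_apply]
  rw [h]
  exact (ContinuousLinearMap.contDiff _).comp_contDiffOn
    (hG.contDiffOn_toOp_inv.clm_apply contDiffOn_const)

theorem contDiffOn_pd (l i j : Fin n) : ContDiffOn ℝ ∞ (pd l fun z => G z i j) U :=
  ((hG.smooth i j).fderiv_of_isOpen hG.isOpen (by simp)).clm_apply contDiffOn_const

theorem contDiffOn_christoffel (k i j : Fin n) : ContDiffOn ℝ ∞ (christoffel G k i j) U := by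
  unfold christoffel
  exact contDiffOn_const.mul <| ContDiffOn.sum fun l _ => (hG.contDiffOn_inv k l).mul
    (((hG.contDiffOn_pd i j l).add (hG.contDiffOn_pd j i l)).sub (hG.contDiffOn_pd l i j))

theorem contDiffOn_gam : ContDiffOn ℝ ∞ (gam G) U := by
  have h : gam G = fun z => ∑ i, ContinuousLinearMap.smulRightL ℝ (Coord n)
      (Coord n →L[ℝ] Coord n) (EuclideanSpace.proj i : Coord n →L[ℝ] ℝ)
        (toOp (christoffelMatrix G i z)) := rfl
  rw [h]
  exact ContDiffOn.sum fun i _ => (ContinuousLinearMap.contDiff _).comp_contDiffOn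
    (contDiffOn_toOp fun k j => hG.contDiffOn_christoffel k i j)

theorem contDiffOn_sqrt_det : ContDiffOn ℝ ∞ (fun z => √(G z).det) U :=
  (contDiffOn_det hG.smooth).sqrt fun z hz => (hG.posDef z hz).det_pos.ne'

/-- `∂ᵥ √(det g) = √(det g) tr Γᵥ`. -/
theorem fderiv_sqrt_det (hy : y ∈ U) (v : Coord n) :
    fderiv ℝ (fun z => √(G z).det) y v = √(G y).det * ∑ k, gam G y v (stdVec k) k := by
  have hpos := (hG.posDef y hy).det_pos
  have h1 := (hasFDerivWithinAt_det (s := univ)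
    fun i j => (hG.hasFDerivAt hy i j).hasFDerivWithinAt).hasFDerivAt_of_univ
  have hadj : (G y).adjugate = (G y).det • (G y)⁻¹ := by
    rw [Matrix.inv_def, smul_smul, Ring.inverse_eq_inv', mul_inv_cancel₀ hpos.ne', one_smul]
  -- By metric compatibility the logarithmic derivative of `det g` is `2 tr Γ`; the factor 2 is
  -- absorbed by the derivative of the square root.
  have htr : ∀ i, ((G y)⁻¹ * ((christoffelMatrix G i y).transpose * G y
      + G y * christoffelMatrix G i y)).trace = 2 * (christoffelMatrix G i y).trace := by
    intro i
    rw [mul_add, Matrix.trace_add, ← mul_assoc (G y)⁻¹ (G y),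
      Matrix.nonsing_inv_mul _ (hG.isUnit_det hy), one_mul, Matrix.trace_mul_comm, mul_assoc,
      Matrix.mul_nonsing_inv _ (hG.isUnit_det hy), mul_one, Matrix.trace_transpose]
    ring
  rw [(h1.sqrt hpos.ne').fderiv, smul_apply, 
    sum_det_deriv (G y) (fun i j => fderiv ℝ (fun z => G z i j) y) v, hG.fderiv_entry hy,
    hadj, Matrix.smul_mul, Matrix.trace_smul, Matrix.mul_sum, Matrix.trace_sum]
  simp only [Matrix.mul_smul, Matrix.trace_smul, htr, gam_apply, sum_apply, smul_apply,
    smul_eq_mul]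
  have h4 : ∀ k, (∑ i, v i • toOp (christoffelMatrix G i y) (stdVec k)) k =
      ∑ i, v i * christoffelMatrix G i y k k := by
    intro k
    simp [toOp_apply, stdVec_apply]
  simp only [h4, Matrix.trace, Matrix.diag_apply]
  rw [Finset.sum_comm]
  simp only [Finset.mul_sum]
  have h5 : (G y).det = √(G y).det * √(G y).det := (Real.mul_self_sqrt hpos.le).symm
  have h6 : √(G y).det ≠ 0 := (Real.sqrt_pos.2 hpos).ne'
  refine Finset.sum_congr rfl fun i _ => Finset.sum_congr rfl fun k _ => ?_
  field_simp
  rw [Real.sq_sqrt hpos.le]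

end MetricOn

/-- The form `ω(v₁, …, vₚ) = β(A v₁, …, A vₚ)`, whose components are those of `β` with raised
indices. -/
def raise {p : ℕ} (G : Coord n → Matrix (Fin n) (Fin n) ℝ) (β : Coord n → Coord n [⋀^Fin p]→L[ℝ] ℝ)
    (y : Coord n) : Coord n [⋀^Fin p]→L[ℝ] ℝ :=
  (β y).compContinuousLinearMap (toOp (G y)⁻¹)

/-- Differentiating `g⁻¹` in each slot gives `-Γ g⁻¹ - g⁻¹Γᵀ`. The first part completes `∂β` to
`∇β`; the second stays behind as the connection term for upper indices. -/
theorem MetricOn.hasFDerivAt_raise (hG : MetricOn G U) (hy : y ∈ U) {p : ℕ}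
    {β : Coord n → Coord n [⋀^Fin p]→L[ℝ] ℝ} (hβ : DifferentiableAt ℝ β y) :
    ∃ L : Coord n →L[ℝ] Coord n [⋀^Fin p]→L[ℝ] ℝ, HasFDerivAt (raise G β) L y ∧
    ∀ v, L v = (nabla (gam G) β y v).compContinuousLinearMap (toOp (G y)⁻¹) -
      act (raise G β y) (ContinuousLinearMap.adjoint (gam G y v)) := by
  obtain ⟨A', hA', hA'v⟩ := hG.hasFDerivAt_toOp_inv hy
  refine ⟨_, hβ.hasFDerivAt.continuousAlternatingMapCompContinuousLinearMap hA', fun v => ?_⟩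
  have h1 : (β y).fderivCompContinuousLinearMap (toOp (G y)⁻¹) (A' v) =
      - (act (β y) (gam G y v)).compContinuousLinearMap (toOp (G y)⁻¹)
      - act (raise G β y) (ContinuousLinearMap.adjoint (gam G y v)) := by
    rw [hA'v, map_sub, map_neg]
    ext x
    simp only [ContinuousAlternatingMap.sub_apply, ContinuousAlternatingMap.neg_apply,
      ContinuousAlternatingMap.compContinuousLinearMap_apply, raise,
      ContinuousAlternatingMap.fderivCompContinuousLinearMap_apply, act_apply]
    have e1 : ∀ a, (fun j => Function.update (fun _ => toOp (G y)⁻¹) a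
        ((gam G y v).comp (toOp (G y)⁻¹)) j (x j)) =
        Function.update (toOp (G y)⁻¹ ∘ x) a (gam G y v ((toOp (G y)⁻¹ ∘ x) a)) := by
      intro a
      funext j
      rcases eq_or_ne j a with rfl | h <;> simp [*]
    have e2 : ∀ a, (fun j => Function.update (fun _ => toOp (G y)⁻¹) a
        ((toOp (G y)⁻¹).comp (ContinuousLinearMap.adjoint (gam G y v))) j (x j)) =
        toOp (G y)⁻¹ ∘ Function.update x a (ContinuousLinearMap.adjoint (gam G y v) (x a)) := by
      intro a
      funext j
      rcases eq_or_ne j a with rfl | h <;> simp [*]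
    simp only [e1, e2]
    ring
  ext x
  have h2 := DFunLike.congr_fun h1 x
  simp only [ContinuousAlternatingMap.sub_apply, ContinuousAlternatingMap.neg_apply] at h2
  change (fderiv ℝ β y v).compContinuousLinearMap _ x
    + (β y).fderivCompContinuousLinearMap (toOp (G y)⁻¹) (A' v) x = _
  rw [h2, nabla_apply]
  simp only [ContinuousAlternatingMap.sub_apply,
    ContinuousAlternatingMap.compContinuousLinearMap_apply]
  ring

end LocalMetric

/-! ### Integration by parts and the fundamental lemma on an open set -/

section Integration

variable {E : Type*} [NormedAddCommGroup E] [MeasurableSpace E] [BorelSpace E] {μ : Measure E}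
  {U : Set E}

theorem integrable_mul_of_tsupport_subset [IsFiniteMeasureOnCompacts μ] {ψ b : E → ℝ} (hψ : Continuous ψ)
    (hc : HasCompactSupport ψ) (hs : tsupport ψ ⊆ U) (hU : IsOpen U) (hb : ContinuousOn b U) :
    Integrable (fun y => ψ y * b y) μ := by
  have h1 : tsupport (fun y => ψ y * b y) ⊆ tsupport ψ := tsupport_mul_subset_left
  refine Continuous.integrable_of_hasCompactSupport ?_ (hc.mul_right (f' := b))
  exact (hψ.continuousOn.mul hb).continuous_of_tsupport_subset hU (h1.trans hs)

variable [NormedSpace ℝ E] [FiniteDimensional ℝ E] [μ.IsAddHaarMeasure]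

/-- Integration by parts against a test function supported in an open set. -/
theorem setIntegral_fderiv_mul_eq_neg {ψ b : E → ℝ} (hψ : ContDiff ℝ ∞ ψ)
    (hc : HasCompactSupport ψ) (hs : tsupport ψ ⊆ U) (hU : IsOpen U) (hb : ContDiffOn ℝ ∞ b U)
    (v : E) :
    ∫ y in U, fderiv ℝ ψ y v * b y ∂μ = - ∫ y in U, ψ y * fderiv ℝ b y v ∂μ := by
  have hs' : tsupport (fun y => fderiv ℝ ψ y v) ⊆ tsupport ψ := tsupport_fderiv_apply_subset ℝ v
  have hcd : Continuous fun y => fderiv ℝ ψ y v :=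
    (hψ.continuous_fderiv (by simp)).clm_apply continuous_const
  have hbd : ContinuousOn (fun y => fderiv ℝ b y v) U :=
    (hb.continuousOn_fderiv_of_isOpen hU (by simp)).clm_apply continuousOn_const
  have i1 : Integrable (fun y => fderiv ℝ ψ y v * b y) μ :=
    integrable_mul_of_tsupport_subset hcd (hc.fderiv_apply ℝ v) (hs'.trans hs) hU hb.continuousOn
  have i2 : Integrable (fun y => ψ y * fderiv ℝ b y v) μ :=
    integrable_mul_of_tsupport_subset hψ.continuous hc hs hU hbd
  have i3 : Integrable (fun y => ψ y * b y) μ :=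
    integrable_mul_of_tsupport_subset hψ.continuous hc hs hU hb.continuousOn
  have h0 : ∀ (f c : E → ℝ), tsupport f ⊆ U → ∀ x ∉ U, f x * c x = 0 := by
    intro f c hf x hx
    rw [image_eq_zero_of_notMem_tsupport fun h => hx (hf h), zero_mul]
  -- Both integrands vanish off `U`, so the identity reduces to integration by parts on the whole
  -- space, without boundary terms.
  rw [setIntegral_eq_integral_of_forall_compl_eq_zero (h0 _ _ (hs'.trans hs)),
    setIntegral_eq_integral_of_forall_compl_eq_zero (h0 _ _ hs)]
  rw [integral_mul_fderiv_eq_neg_fderiv_mul_of_integrable i1 i2 i3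
    (fun x _ => hψ.differentiable (by simp) x)
    (fun x hx => (hb.contDiffAt (hU.mem_nhds (hs hx))).differentiableAt (by simp)), neg_neg]

/-- The fundamental lemma of the calculus of variations for continuous functions. -/
theorem eq_zero_of_forall_setIntegral_mul_eq_zero {h : E → ℝ} (hU : IsOpen U)
    (hh : ContinuousOn h U)
    (H : ∀ ψ : E → ℝ, ContDiff ℝ ∞ ψ → HasCompactSupport ψ → tsupport ψ ⊆ U →
      ∫ y in U, ψ y * h y ∂μ = 0) {y : E} (hy : y ∈ U) : h y = 0 := by
  have h1 : ∀ᵐ x ∂μ, x ∈ U → h x = 0 := by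
    refine hU.ae_eq_zero_of_integral_contDiff_smul_eq_zero
      (hh.locallyIntegrableOn hU.measurableSet) fun ψ hψ hc hs => ?_
    rw [← H ψ hψ hc hs, setIntegral_eq_integral_of_forall_compl_eq_zero]
    · rfl
    · intro x hx
      rw [image_eq_zero_of_notMem_tsupport fun h' => hx (hs h'), zero_mul]
  have h2 : h =ᵐ[μ.restrict U] fun _ => 0 := by
    rwa [Filter.EventuallyEq, ae_restrict_iff' hU.measurableSet]
  exact Measure.eqOn_open_of_ae_eq h2 hU hh continuousOn_const hy

end Integration

/-! ### From the formal adjoint of `d` to its coordinate formula -/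

section Codifferential

variable {n p : ℕ}

/-- The Euclidean full contraction of two forms. -/
def dotForm (S W : Coord n [⋀^Fin p]→L[ℝ] ℝ) : ℝ :=
  ∑ I : Fin p → Fin n, S (fun a => stdVec (I a)) * W (fun a => stdVec (I a))

theorem form_ext {S W : Coord n [⋀^Fin p]→L[ℝ] ℝ}
    (h : ∀ I : Fin p → Fin n, S (fun a => stdVec (I a)) = W (fun a => stdVec (I a))) : S = W := by
  ext v
  have key : ∀ S : Coord n [⋀^Fin p]→L[ℝ] ℝ, S v =
      ∑ I : Fin p → Fin n, (∏ a, v a (I a)) * S (fun a => stdVec (I a)) := by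
    intro S
    have hv : v = fun a => ∑ i, v a i • stdVec i := funext fun a => (sum_smul_stdVec (v a)).symm
    conv_lhs => rw [hv]
    rw [S.map_sum]
    exact Finset.sum_congr rfl fun I _ => S.toMultilinearMap.map_smul_univ _ _
  rw [key S, key W]
  simp only [h]

theorem eq_zero_of_dotForm_self {S : Coord n [⋀^Fin p]→L[ℝ] ℝ} (h : dotForm S S = 0) : S = 0 := by
  refine form_ext fun I => ?_
  have := (Finset.sum_eq_zero_iff_of_nonneg fun I _ => mul_self_nonneg _).1 h I (Finset.mem_univ I)
  simpa using this

/-- Passage from full contraction with `g⁻¹` to a Euclidean contraction against a form with raised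
indices. -/
theorem tensorInner_comps (A : Matrix (Fin n) (Fin n) ℝ) (hA : A.transpose = A)
    (S W : Coord n [⋀^Fin p]→L[ℝ] ℝ) :
    tensorInner A (comps S) (comps W) = dotForm S (W.compContinuousLinearMap (toOp A)) := by
  unfold tensorInner dotForm comps
  refine Finset.sum_congr rfl fun I _ => ?_
  have h : (toOp A ∘ fun a => stdVec (I a)) = fun a => ∑ j, A (I a) j • stdVec j := by
    funext a
    rw [Function.comp_apply, toOp_stdVec]
    refine Finset.sum_congr rfl fun j _ => ?_
    rw [← hA, Matrix.transpose_apply, hA]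
  rw [ContinuousAlternatingMap.compContinuousLinearMap_apply, h, W.map_sum, Finset.mul_sum]
  refine Finset.sum_congr rfl fun J _ => ?_
  have := W.toMultilinearMap.map_smul_univ (fun a => A (I a) (J a)) (fun a => stdVec (J a))
  refine Eq.trans ?_ (congrArg (S (fun a => stdVec (I a)) * ·) this.symm)
  simp only [smul_eq_mul]
  change _ * S _ * W _ = S _ * (_ * W _)
  ring

/-- Each of the `p + 1` terms of the alternation contributes equally: moving its slot to the front
of `W` produces the same sign again. The factor `p + 1` later matches the normalizations `1/(p+1)!`
and `1/p!`. -/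
theorem dotForm_alternatize (φ : Coord n →L[ℝ] Coord n [⋀^Fin p]→L[ℝ] ℝ)
    (W : Coord n [⋀^Fin (p + 1)]→L[ℝ] ℝ) :
    dotForm (ContinuousAlternatingMap.alternatizeUncurryFin φ) W =
      (p + 1) * ∑ i, dotForm (φ (stdVec i)) (W.curryLeft (stdVec i)) := by
  unfold dotForm
  simp only [ContinuousAlternatingMap.alternatizeUncurryFin_apply, Finset.sum_mul]
  rw [Finset.sum_comm]
  have key : ∀ a : Fin (p + 1), ∑ I : Fin (p + 1) → Fin n,
      ((-1 : ℤ) ^ (a : ℕ) • φ (stdVec (I a)) (a.removeNth fun b => stdVec (I b))) *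
        W (fun b => stdVec (I b)) =
      ∑ i, ∑ J : Fin p → Fin n, φ (stdVec i) (fun b => stdVec (J b)) *
        W.curryLeft (stdVec i) (fun b => stdVec (J b)) := by
    intro a
    rw [← Fintype.sum_prod_type', ← (Fin.insertNthEquiv (fun _ => Fin n) a).sum_comp]
    refine Finset.sum_congr rfl fun x _ => ?_
    obtain ⟨i, J⟩ := x
    have h1 : (fun b => stdVec (Fin.insertNthEquiv (fun _ => Fin n) a (i, J) b) : _ → Coord n) =
        a.insertNth (stdVec i) (fun b => stdVec (J b)) := by
      funext b
      refine Fin.succAboveCases a ?_ (fun c => ?_) b <;> simp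
    have h2 : stdVec (Fin.insertNthEquiv (fun _ => Fin n) a (i, J) a) = (stdVec i : Coord n) := by
      simp
    rw [h2, h1, ContinuousAlternatingMap.map_insertNth, Fin.removeNth_insertNth,
      ContinuousAlternatingMap.curryLeft_apply_apply, smul_mul_smul_comm, ← pow_add,
      Even.neg_one_pow ⟨_, rfl⟩, one_smul]
  simp only [key, Finset.sum_const, Finset.card_univ, Fintype.card_fin, nsmul_eq_mul]
  push_cast
  ring

theorem dotForm_smul_left (c : ℝ) (S W : Coord n [⋀^Fin p]→L[ℝ] ℝ) :
    dotForm (c • S) W = c * dotForm S W := by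
  simp [dotForm, Finset.mul_sum, mul_assoc]

/-- `dotForm` as a continuous linear functional of its second argument. -/
def dotFormL (S : Coord n [⋀^Fin p]→L[ℝ] ℝ) : (Coord n [⋀^Fin p]→L[ℝ] ℝ) →L[ℝ] ℝ :=
  ∑ I : Fin p → Fin n, S (fun a => stdVec (I a)) •
    ContinuousAlternatingMap.apply ℝ (Coord n) ℝ (fun a => stdVec (I a))

theorem dotFormL_apply (S W : Coord n [⋀^Fin p]→L[ℝ] ℝ) : dotFormL S W = dotForm S W := by
  simp [dotFormL, dotForm]

theorem inner_stdVec (q : Fin n) (v : Coord n) : inner ℝ (stdVec q) v = v q := by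
  rw [stdVec, EuclideanSpace.inner_single_left]
  simp

/-- For each remaining slot of `W` the sum pairs the antisymmetry of `W` in that slot and the first
with the symmetry of `Γ`. -/
theorem sum_act_curryLeft_adjoint {G : Coord n → Matrix (Fin n) (Fin n) ℝ} {U : Set (Coord n)}
    (hG : MetricOn G U) {y : Coord n} (hy : y ∈ U) (W : Coord n [⋀^Fin (p + 1)]→L[ℝ] ℝ) :
    ∑ i, act (W.curryLeft (stdVec i)) (ContinuousLinearMap.adjoint (gam G y (stdVec i))) = 0 := by
  ext x
  rw [ContinuousAlternatingMap.sum_apply]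
  simp only [act_apply, ContinuousAlternatingMap.curryLeft_apply_apply]
  rw [Finset.sum_comm]
  change _ = (0 : ℝ)
  refine Finset.sum_eq_zero fun a _ => ?_
  have hadj : ∀ i, ContinuousLinearMap.adjoint (gam G y (stdVec i)) (x a) =
      ∑ q, inner ℝ (gam G y (stdVec i) (stdVec q)) (x a) • stdVec q := by
    intro i
    rw [← sum_smul_stdVec (ContinuousLinearMap.adjoint (gam G y (stdVec i)) (x a))]
    refine Finset.sum_congr rfl fun q _ => ?_
    congr 1
    rw [← ContinuousLinearMap.adjoint_inner_right, inner_stdVec]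
  have hlin : ∀ (w : Coord n) (c : Fin n → ℝ), W (Matrix.vecCons w
      (Function.update x a (∑ q, c q • stdVec q))) =
      ∑ q, c q * W (Matrix.vecCons w (Function.update x a (stdVec q))) := by
    intro w c
    have := map_sum ((W.curryLeft w).toContinuousMultilinearMap.toContinuousLinearMap x a)
      (fun q => c q • stdVec q) Finset.univ
    simp only [map_smul] at this
    exact this
  have hanti : ∀ u w : Coord n, W (Matrix.vecCons u (Function.update x a w)) =
      - W (Matrix.vecCons w (Function.update x a u)) := by
    intro u w
    have h := W.map_swap (Matrix.vecCons u (Function.update x a w)) (i := 0) (j := a.succ)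
      (Fin.succ_ne_zero a).symm
    rw [← neg_eq_iff_eq_neg]
    refine h.symm.trans (congrArg W ?_)
    funext j
    refine Fin.cases ?_ (fun k => ?_) j
    · simp
    · by_cases hk : k = a
      · subst hk
        simp
      · rw [Function.comp_apply, Equiv.swap_apply_of_ne_of_ne (Fin.succ_ne_zero k)
          (fun h => hk (Fin.succ_injective _ h))]
        simp [hk]
  simp only [hadj, hlin]
  have hsum : ∀ f : Fin n → Fin n → ℝ, (∀ i q, f i q = - f q i) → ∑ i, ∑ q, f i q = 0 := by
    intro f hf
    have : ∑ i, ∑ q, f i q = - ∑ i, ∑ q, f i q := by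
      conv_lhs => rw [Finset.sum_comm]
      simp only [← Finset.sum_neg_distrib]
      exact Finset.sum_congr rfl fun i _ => Finset.sum_congr rfl fun q _ => hf q i
    linarith
  refine hsum _ fun i q => ?_
  rw [hG.gam_symm hy (stdVec i) (stdVec q), hanti (stdVec i)]
  ring

theorem raise_apply_stdVec {G : Coord n → Matrix (Fin n) (Fin n) ℝ} {U : Set (Coord n)}
    (hG : MetricOn G U) {y : Coord n} (hy : y ∈ U) (β : Coord n → Coord n [⋀^Fin p]→L[ℝ] ℝ)
    (I : Fin p → Fin n) : raise G β y (fun a => stdVec (I a)) =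
      ∑ J : Fin p → Fin n, (∏ a, (G y)⁻¹ (I a) (J a)) * β y (fun a => stdVec (J a)) := by
  have h : (toOp (G y)⁻¹ ∘ fun a => stdVec (I a)) =
      fun a => ∑ j, (G y)⁻¹ (I a) j • stdVec j := by
    funext a
    rw [Function.comp_apply, toOp_stdVec]
    refine Finset.sum_congr rfl fun j _ => ?_
    rw [← hG.transpose_inv hy, Matrix.transpose_apply, hG.transpose_inv hy]
  rw [raise, ContinuousAlternatingMap.compContinuousLinearMap_apply, h, (β y).map_sum]
  exact Finset.sum_congr rfl fun J _ => (β y).toMultilinearMap.map_smul_univ _ _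

theorem contDiffOn_raise_apply {G : Coord n → Matrix (Fin n) (Fin n) ℝ} {U : Set (Coord n)}
    (hG : MetricOn G U) {β : Coord n → Coord n [⋀^Fin p]→L[ℝ] ℝ} (hβ : ContDiffOn ℝ ∞ β U)
    (I : Fin p → Fin n) : ContDiffOn ℝ ∞ (fun y => raise G β y (fun a => stdVec (I a))) U := by
  refine ContDiffOn.congr (f := fun y => ∑ J : Fin p → Fin n, (∏ a, (G y)⁻¹ (I a) (J a)) *
    β y (fun a => stdVec (J a))) ?_ fun y hy => raise_apply_stdVec hG hy β I
  refine ContDiffOn.sum fun J _ => (contDiffOn_prod fun a _ => hG.contDiffOn_inv _ _).mul ?_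
  exact (ContinuousAlternatingMap.apply ℝ (Coord n) ℝ (fun a => stdVec (J a))).contDiff.comp_contDiffOn
    hβ

/-- The first-slot connection term in the divergence of a raised form equals the trace of `Γ`, which
is exactly what the derivative of `√det g` supplies. -/
theorem sum_adjoint_gam_stdVec {G : Coord n → Matrix (Fin n) (Fin n) ℝ} {U : Set (Coord n)}
    (hG : MetricOn G U) {y : Coord n} (hy : y ∈ U) :
    ∑ i, ContinuousLinearMap.adjoint (gam G y (stdVec i)) (stdVec i) =
      ∑ i, (∑ k, gam G y (stdVec i) (stdVec k) k) • stdVec i := by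
  have hc : ∀ (v : Coord n) (q : Fin n), v q = inner ℝ (stdVec q) v := fun v q =>
    (inner_stdVec q v).symm
  ext q
  rw [hc, hc, inner_sum, inner_sum]
  have hi : ∀ i, inner ℝ (stdVec q : Coord n) (stdVec i) = if q = i then 1 else 0 := by
    intro i
    rw [← hc, stdVec_apply]
  simp only [ContinuousLinearMap.adjoint_inner_right, inner_smul_right, hi, mul_ite, mul_one,
    mul_zero, Finset.sum_ite_eq, Finset.mem_univ, if_true]
  refine Finset.sum_congr rfl fun i _ => ?_
  rw [hG.gam_symm hy, real_inner_comm, ← hc]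

/-- The coordinate formula `d*β = -gⁱʲ ∇ᵢβ(∂ⱼ, ·)` for the formal adjoint of `d`. -/
theorem IsCodifferential.eq_neg_sum {G : Coord n → Matrix (Fin n) (Fin n) ℝ} {U : Set (Coord n)}
    (hG : MetricOn G U) {β : Coord n → Coord n [⋀^Fin (p + 1)]→L[ℝ] ℝ}
    {η : Coord n → Coord n [⋀^Fin p]→L[ℝ] ℝ} (hβ : ContDiffOn ℝ ∞ β U)
    (h : IsCodifferential G U β η) {y : Coord n} (hy : y ∈ U) :
    η y = - ∑ i, (nabla (gam G) β y (stdVec i)).curryLeft (toOp (G y)⁻¹ (stdVec i)) := by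
  set B : Coord n → Coord n [⋀^Fin (p + 1)]→L[ℝ] ℝ := fun z => √(G z).det • raise G β z with hB
  let ι : Fin n → (Coord n [⋀^Fin (p + 1)]→L[ℝ] ℝ) →L[ℝ] Coord n [⋀^Fin p]→L[ℝ] ℝ := fun i =>
    (ContinuousAlternatingMap.curryLeftLI (𝕜 := ℝ) (E := Coord n) (F := ℝ)
      (n := p)).toContinuousLinearMap.flip (stdVec i)
  have hβd : ∀ z ∈ U, DifferentiableAt ℝ β z := fun z hz =>
    (hβ.contDiffAt (hG.isOpen.mem_nhds hz)).differentiableAt (by simp)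
  have hsq : ∀ z ∈ U, DifferentiableAt ℝ (fun z => √(G z).det) z := fun z hz =>
    (hG.contDiffOn_sqrt_det.contDiffAt (hG.isOpen.mem_nhds hz)).differentiableAt (by simp)
  have hBd : ∀ z ∈ U, DifferentiableAt ℝ B z := by
    intro z hz
    obtain ⟨L, hL, -⟩ := hG.hasFDerivAt_raise hz (hβd z hz)
    exact (hsq z hz).smul hL.differentiableAt
  -- The weak equation in divergence form: `X = 0` says that the raised `η` is `-(1/√det g) ∂ᵢ(√det
  -- g βⁱ…)`.
  set X : Coord n [⋀^Fin p]→L[ℝ] ℝ :=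
    √(G y).det • raise G η y + ∑ i, ι i (fderiv ℝ B y (stdVec i)) with hX
  have hweak : ∀ γ : Coord n [⋀^Fin p]→L[ℝ] ℝ, dotForm γ X = 0 := by
    intro γ
    set b : Fin n → Coord n → ℝ := fun i z => dotForm γ ((B z).curryLeft (stdVec i)) with hb
    have hbs : ∀ i, ContDiffOn ℝ ∞ (b i) U := by
      intro i
      refine ContDiffOn.sum fun J _ => contDiffOn_const.mul ?_
      refine ContDiffOn.congr (hG.contDiffOn_sqrt_det.mul
        (contDiffOn_raise_apply hG hβ (Fin.cons i J))) fun z hz => ?_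
      have hv : (Matrix.vecCons (stdVec i) fun a => stdVec (J a) : _ → Coord n) =
          fun a => stdVec ((Fin.cons i J : Fin (p + 1) → Fin n) a) := by
        funext a
        refine Fin.cases ?_ (fun k => ?_) a <;> simp
      rw [ContinuousAlternatingMap.curryLeft_apply_apply, hv]
      rfl
    have hbd : ∀ i, ∀ z ∈ U, ∀ v, fderiv ℝ (b i) z v = dotForm γ (ι i (fderiv ℝ B z v)) := by
      intro i z hz v
      have := hasFDerivAt_clm_comp (X := Coord n) (Y := Coord n [⋀^Fin (p + 1)]→L[ℝ] ℝ) (Z := ℝ)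
        ((dotFormL γ).comp (ι i)) (hBd z hz).hasFDerivAt
      have hbe : b i = fun z => ((dotFormL γ).comp (ι i)) (B z) := by
        funext z
        exact (dotFormL_apply _ _).symm
      rw [hbe, this.fderiv]
      exact dotFormL_apply _ _
    set c : Coord n → ℝ := fun z => √(G z).det * dotForm γ (raise G η z) with hc
    have hcs : ContDiffOn ℝ ∞ c U := hG.contDiffOn_sqrt_det.mul <|
      ContDiffOn.sum fun J _ => contDiffOn_const.mul (contDiffOn_raise_apply hG h.1 J)
    have hcont : ContinuousOn (fun z => c z + ∑ i, fderiv ℝ (b i) z (stdVec i)) U :=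
      hcs.continuousOn.add <| continuousOn_finsetSum _ fun i _ =>
        ((hbs i).continuousOn_fderiv_of_isOpen hG.isOpen (by simp)).clm_apply continuousOn_const
    have hfin := eq_zero_of_forall_setIntegral_mul_eq_zero (μ := volume) hG.isOpen hcont ?_ hy
    · rw [hX, ← dotFormL_apply, map_add, map_smul, map_sum]
      simp only [dotFormL_apply, ← hbd _ y hy]
      exact hfin
    intro ψ hψ hψc hψs
    -- Test forms `ψ γ` with `γ` constant suffice: `d(ψ γ)` involves only the gradient of `ψ`, which
    -- is then moved onto the other factor.
    have hα := h.2 (fun z => ψ z • γ) (hψ.smul contDiff_const) hψc.smul_right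
      ((tsupport_smul_subset_left _ _).trans hψs)
    have hfac : ((p + 1).factorial : ℝ) = (p + 1) * p.factorial := by
      push_cast [Nat.factorial_succ]
      ring
    have hpf : (p.factorial : ℝ) ≠ 0 := by positivity
    have hp1 : (p + 1 : ℝ) ≠ 0 := by positivity
    have hleft : ∀ z ∈ U, formInner (G z)⁻¹ (extDeriv (fun z => ψ z • γ) z) (β z) * √(G z).det =
        (1 / (p.factorial : ℝ)) * ∑ i, fderiv ℝ ψ z (stdVec i) * b i z := by
      intro z hz
      have hd : ∀ v, fderiv ℝ (fun z => ψ z • γ) z v = fderiv ℝ ψ z v • γ := by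
        intro v
        rw [((hψ.differentiable (by simp) z).hasFDerivAt.smul_const γ).fderiv]
        rfl
      rw [formInner, tensorInner_comps _ (hG.transpose_inv hz), extDeriv, dotForm_alternatize]
      simp only [hd, dotForm_smul_left, hb, hB]
      have : ∀ i, dotForm γ ((√(G z).det • raise G β z).curryLeft (stdVec i)) =
          √(G z).det * dotForm γ ((raise G β z).curryLeft (stdVec i)) := by
        intro i
        rw [ContinuousAlternatingMap.curryLeft_smul, smul_apply, ← dotFormL_apply, map_smul,
          dotFormL_apply, smul_eq_mul]
      simp only [this, hfac]
      rw [Finset.mul_sum, Finset.mul_sum, Finset.mul_sum, Finset.sum_mul]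
      refine Finset.sum_congr rfl fun i _ => ?_
      simp only [raise]
      field_simp
    have hright : ∀ z ∈ U, formInner (G z)⁻¹ (ψ z • γ) (η z) * √(G z).det =
        (1 / (p.factorial : ℝ)) * (ψ z * c z) := by
      intro z hz
      rw [formInner, tensorInner_comps _ (hG.transpose_inv hz), dotForm_smul_left, hc]
      simp only [raise]
      ring
    rw [setIntegral_congr_fun hG.isOpen.measurableSet hleft,
      setIntegral_congr_fun hG.isOpen.measurableSet hright, integral_const_mul,
      integral_const_mul] at hα
    have hα' := mul_left_cancel₀ (by positivity) hα
    have hcd : ∀ v, Continuous fun z => fderiv ℝ ψ z v := fun v =>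
      (hψ.continuous_fderiv (by simp)).clm_apply continuous_const
    rw [integral_finsetSum] at hα'
    swap
    · intro i _
      exact (integrable_mul_of_tsupport_subset (hcd _) (hψc.fderiv_apply ℝ _)
        ((tsupport_fderiv_apply_subset ℝ _).trans hψs) hG.isOpen
        (hbs i).continuousOn).integrableOn
    simp only [setIntegral_fderiv_mul_eq_neg hψ hψc hψs hG.isOpen (hbs _)] at hα'
    simp only [mul_add, Finset.mul_sum]
    rw [integral_add, integral_finsetSum, ← hα', Finset.sum_neg_distrib, neg_add_cancel]
    · intro i _
      exact (integrable_mul_of_tsupport_subset hψ.continuous hψc hψs hG.isOpen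
        (((hbs i).continuousOn_fderiv_of_isOpen hG.isOpen (by simp)).clm_apply
          continuousOn_const)).integrableOn
    · exact (integrable_mul_of_tsupport_subset hψ.continuous hψc hψs hG.isOpen
        hcs.continuousOn).integrableOn
    · exact integrable_finsetSum _ fun i _ =>
        (integrable_mul_of_tsupport_subset hψ.continuous hψc hψs hG.isOpen
        (((hbs i).continuousOn_fderiv_of_isOpen hG.isOpen (by simp)).clm_apply
          continuousOn_const)).integrableOn
  have hX0 : X = 0 := eq_zero_of_dotForm_self (hweak X)
  obtain ⟨L, hL, hLv⟩ := hG.hasFDerivAt_raise hy (hβd y hy)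
  set W := raise G β y with hW
  set A := toOp (G y)⁻¹ with hA
  set Z := η y + ∑ i, (nabla (gam G) β y (stdVec i)).curryLeft (A (stdVec i)) with hZ
  have hBi : ∀ i, ι i (fderiv ℝ B y (stdVec i)) = √(G y).det •
      (((nabla (gam G) β y (stdVec i)).curryLeft (A (stdVec i))).compContinuousLinearMap A
        - act (W.curryLeft (stdVec i)) (ContinuousLinearMap.adjoint (gam G y (stdVec i)))
        - W.curryLeft (ContinuousLinearMap.adjoint (gam G y (stdVec i)) (stdVec i))
        + W.curryLeft ((∑ k, gam G y (stdVec i) (stdVec k) k) • stdVec i)) := by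
    intro i
    have h1 : fderiv ℝ B y (stdVec i) = √(G y).det • L (stdVec i)
        + (fderiv ℝ (fun z => √(G z).det) y (stdVec i)) • W := by
      rw [hB, ((hsq y hy).hasFDerivAt.fun_smul hL).fderiv]
      rfl
    rw [h1, hLv, hG.fderiv_sqrt_det hy]
    have h2 := act_curryLeft W (ContinuousLinearMap.adjoint (gam G y (stdVec i))) (stdVec i)
    ext x
    have h3 := DFunLike.congr_fun h2 x
    have h4 := DFunLike.congr_fun (ContinuousAlternatingMap.curryLeft_compContinuousLinearMap
      (nabla (gam G) β y (stdVec i)) A (stdVec i)) x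
    rw [map_smul]
    simp only [ContinuousAlternatingMap.sub_apply, ContinuousAlternatingMap.add_apply,
      ContinuousAlternatingMap.smul_apply, ContinuousAlternatingMap.curryLeft_apply_apply,
      smul_eq_mul] at h3 h4 ⊢
    rw [h3, ← h4, map_add, map_smul, map_smul, map_sub]
    simp only [ContinuousAlternatingMap.sub_apply, ContinuousAlternatingMap.add_apply,
      ContinuousAlternatingMap.smul_apply, smul_eq_mul]
    change _ * ((nabla (gam G) β y (stdVec i)).compContinuousLinearMap A
      (Matrix.vecCons (stdVec i) x) - _) + _ * _ * W (Matrix.vecCons (stdVec i) x) = _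
    change _ * (_ - act W _ (Matrix.vecCons (stdVec i) x)) + _ = _
    ring
  have hZA : Z.compContinuousLinearMap A = 0 := by
    have h1 : X = √(G y).det • Z.compContinuousLinearMap A := by
      rw [hX]
      simp only [hBi]
      rw [← Finset.smul_sum, ← smul_add]
      congr 1
      -- After summation over `i` the action on the remaining slots vanishes, and the first-slot
      -- term cancels the derivative of the volume density, leaving only `∇β`.
      rw [Finset.sum_add_distrib, Finset.sum_sub_distrib, Finset.sum_sub_distrib,
        sum_act_curryLeft_adjoint hG hy, ← map_sum, ← map_sum, sum_adjoint_gam_stdVec hG hy,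
        sub_zero, sub_add_cancel]
      ext x
      simp only [hZ, raise, ContinuousAlternatingMap.compContinuousLinearMap_apply,
        ContinuousAlternatingMap.add_apply, ContinuousAlternatingMap.sum_apply, hA]
    rw [h1] at hX0
    exact (smul_eq_zero.1 hX0).resolve_left
      (Real.sqrt_pos.2 (hG.posDef y hy).det_pos).ne'
  have hZ0 : Z = 0 := by
    ext x
    -- Lowering the indices again by applying `g` to every argument undoes the precomposition with
    -- `g⁻¹`.
    have h1 := DFunLike.congr_fun hZA (toOp (G y) ∘ x)
    rw [ContinuousAlternatingMap.compContinuousLinearMap_apply] at h1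
    have h2 : A ∘ (toOp (G y) ∘ x) = x := by
      funext a
      exact DFunLike.congr_fun (hG.toOp_inv_comp hy) (x a)
    rw [h2] at h1
    exact h1
  exact eq_neg_of_add_eq_zero_left hZ0

end Codifferential

/-! ### The inner product of forms and the second-derivative test -/

section Bochner

variable {n p : ℕ}

/-- Trace identity `∑ᵢ b(M eᵢ, eᵢ) = ∑ᵢ b(eᵢ, Mᵀ eᵢ)`. -/
theorem sum_bilin_adjoint {V : Type*} [AddCommGroup V] [Module ℝ V]
    (b : Coord n →ₗ[ℝ] Coord n →ₗ[ℝ] V) (M : Coord n →L[ℝ] Coord n) :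
    ∑ i, b (M (stdVec i)) (stdVec i) =
      ∑ i, b (stdVec i) (ContinuousLinearMap.adjoint M (stdVec i)) := by
  have h1 : ∀ i, b (M (stdVec i)) (stdVec i) =
      ∑ j, inner ℝ (stdVec j) (M (stdVec i)) • b (stdVec j) (stdVec i) := by
    intro i
    conv_lhs => rw [← sum_smul_stdVec (M (stdVec i))]
    simp [inner_stdVec]
  have h2 : ∀ i, b (stdVec i) (ContinuousLinearMap.adjoint M (stdVec i)) =
      ∑ j, inner ℝ (stdVec i) (M (stdVec j)) • b (stdVec i) (stdVec j) := by
    intro i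
    conv_lhs => rw [← sum_smul_stdVec (ContinuousLinearMap.adjoint M (stdVec i))]
    simp only [← inner_stdVec, ContinuousLinearMap.adjoint_inner_right, map_sum, map_smul]
    exact Finset.sum_congr rfl fun j _ => by rw [real_inner_comm]
  simp only [h1, h2]
  rw [Finset.sum_comm]

theorem map_update_smul_sum (S : Coord n [⋀^Fin p]→L[ℝ] ℝ) (x : Fin p → Coord n) (a : Fin p)
    {κ : Type*} [Fintype κ] (c : κ → ℝ) (f : κ → Coord n) :
    S (Function.update x a (∑ q, c q • f q)) = ∑ q, c q * S (Function.update x a (f q)) := by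
  have := map_sum (S.toContinuousMultilinearMap.toContinuousLinearMap x a)
    (fun q => c q • f q) Finset.univ
  simp only [map_smul] at this
  exact this

/-- Slot by slot this is transposition of a matrix; the involution exchanging the entry of the
multi-index with the summed index matches the two sums. -/
theorem dotForm_act (S W : Coord n [⋀^Fin p]→L[ℝ] ℝ) (M : Coord n →L[ℝ] Coord n) :
    dotForm (act S M) W = dotForm S (act W (ContinuousLinearMap.adjoint M)) := by
  have hM : ∀ (M : Coord n →L[ℝ] Coord n) (i : Fin n),
      M (stdVec i) = ∑ j, inner ℝ (stdVec j) (M (stdVec i)) • stdVec j := by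
    intro M i
    conv_lhs => rw [← sum_smul_stdVec (M (stdVec i))]
    simp only [inner_stdVec]
  have hact : ∀ (S : Coord n [⋀^Fin p]→L[ℝ] ℝ) (M : Coord n →L[ℝ] Coord n) (I : Fin p → Fin n),
      act S M (fun a => stdVec (I a)) = ∑ a, ∑ j, inner ℝ (stdVec j) (M (stdVec (I a))) *
        S (fun b => stdVec (Function.update I a j b)) := by
    intro S M I
    rw [act_apply]
    refine Finset.sum_congr rfl fun a _ => ?_
    conv_lhs => rw [hM, map_update_smul_sum]
    refine Finset.sum_congr rfl fun j _ => ?_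
    congr 2
    funext b
    rcases eq_or_ne b a with rfl | h <;> simp [*]
  unfold dotForm
  simp only [hact, Finset.sum_mul, Finset.mul_sum]
  rw [Finset.sum_comm, Finset.sum_comm (s := Finset.univ (α := Fin p → Fin n))]
  refine Finset.sum_congr rfl fun a _ => ?_
  rw [← Fintype.sum_prod_type', ← Fintype.sum_prod_type']
  let φ : (Fin p → Fin n) × Fin n → (Fin p → Fin n) × Fin n :=
    fun x => (Function.update x.1 a x.2, x.1 a)
  have hφ : Function.Involutive φ := fun x => by simp [φ]
  refine Fintype.sum_equiv hφ.toPerm _ _ fun x => ?_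
  simp only [Function.Involutive.coe_toPerm, φ, Function.update_self, Function.update_idem,
    Function.update_eq_self, ContinuousLinearMap.adjoint_inner_right]
  rw [real_inner_comm]
  ring

theorem compContinuousLinearMap_apply_stdVec (S : Coord n [⋀^Fin p]→L[ℝ] ℝ)
    (M : Coord n →L[ℝ] Coord n) (I : Fin p → Fin n) :
    S.compContinuousLinearMap M (fun a => stdVec (I a)) = ∑ J : Fin p → Fin n,
      (∏ a, inner ℝ (stdVec (J a)) (M (stdVec (I a)))) * S (fun a => stdVec (J a)) := by
  have h : (M ∘ fun a => stdVec (I a)) =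
      fun a => ∑ j, inner ℝ (stdVec j) (M (stdVec (I a))) • stdVec j := by
    funext a
    rw [Function.comp_apply]
    conv_lhs => rw [← sum_smul_stdVec (M (stdVec (I a)))]
    simp only [inner_stdVec]
  rw [ContinuousAlternatingMap.compContinuousLinearMap_apply, h, S.map_sum]
  exact Finset.sum_congr rfl fun J _ => S.toMultilinearMap.map_smul_univ _ _

theorem dotForm_comp (S W : Coord n [⋀^Fin p]→L[ℝ] ℝ) (M : Coord n →L[ℝ] Coord n) :
    dotForm (S.compContinuousLinearMap M) W =
      dotForm S (W.compContinuousLinearMap (ContinuousLinearMap.adjoint M)) := by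
  unfold dotForm
  simp only [compContinuousLinearMap_apply_stdVec, Finset.sum_mul, Finset.mul_sum]
  rw [Finset.sum_comm]
  refine Finset.sum_congr rfl fun I _ => Finset.sum_congr rfl fun J _ => ?_
  simp only [ContinuousLinearMap.adjoint_inner_right]
  simp only [real_inner_comm]
  ring

theorem dotForm_comm (S W : Coord n [⋀^Fin p]→L[ℝ] ℝ) : dotForm S W = dotForm W S :=
  Finset.sum_congr rfl fun _ _ => mul_comm _ _

theorem dotForm_self_nonneg (S : Coord n [⋀^Fin p]→L[ℝ] ℝ) : 0 ≤ dotForm S S :=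
  Finset.sum_nonneg fun _ _ => mul_self_nonneg _

variable {G : Coord n → Matrix (Fin n) (Fin n) ℝ} {U : Set (Coord n)} {y : Coord n}

/-- The pointwise inner product `⟨S, W⟩` (full contraction with `g⁻¹ = A`). -/
def innerForm (A : Matrix (Fin n) (Fin n) ℝ) (S W : Coord n [⋀^Fin p]→L[ℝ] ℝ) : ℝ :=
  dotForm S (W.compContinuousLinearMap (toOp A))

theorem innerForm_eq_dotForm {A P : Matrix (Fin n) (Fin n) ℝ} (hP : P * P.transpose = A)
    (S W : Coord n [⋀^Fin p]→L[ℝ] ℝ) : innerForm A S W =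
      dotForm (S.compContinuousLinearMap (toOp P)) (W.compContinuousLinearMap (toOp P)) := by
  rw [dotForm_comp, ← toOp_transpose, innerForm, ← hP]
  have : W.compContinuousLinearMap (toOp (P * P.transpose)) =
      (W.compContinuousLinearMap (toOp P)).compContinuousLinearMap (toOp P.transpose) := by
    ext x
    simp only [ContinuousAlternatingMap.compContinuousLinearMap_apply, toOp_mul,
      ContinuousLinearMap.coe_comp, Function.comp_assoc]
  rw [this]

open scoped MatrixOrder Matrix.Norms.L2Operator in
theorem exists_mul_transpose_eq {A : Matrix (Fin n) (Fin n) ℝ} (hA : A.PosSemidef) :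
    ∃ P : Matrix (Fin n) (Fin n) ℝ, P * P.transpose = A := by
  refine ⟨CFC.sqrt A, ?_⟩
  have h : (CFC.sqrt A).transpose = CFC.sqrt A := by
    rw [← Matrix.conjTranspose_eq_transpose_of_trivial]
    exact (Matrix.nonneg_iff_posSemidef.1 (CFC.sqrt_nonneg A)).isHermitian
  rw [h]
  exact CFC.sqrt_mul_sqrt_self A hA.nonneg

/-- The columns of `P` form a `g`-orthonormal basis at the single point `y`. The later estimates are
pointwise, so no smooth dependence on `y` is needed. -/
theorem MetricOn.exists_frame (hG : MetricOn G U) (hy : y ∈ U) :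
    ∃ P : Matrix (Fin n) (Fin n) ℝ, P * P.transpose = (G y)⁻¹ :=
  exists_mul_transpose_eq (hG.posDef y hy).inv.posSemidef

theorem MetricOn.innerForm_comm (hG : MetricOn G U) (hy : y ∈ U)
    (S W : Coord n [⋀^Fin p]→L[ℝ] ℝ) : innerForm (G y)⁻¹ S W = innerForm (G y)⁻¹ W S := by
  obtain ⟨P, hP⟩ := hG.exists_frame hy
  rw [innerForm_eq_dotForm hP, innerForm_eq_dotForm hP, dotForm_comm]

theorem MetricOn.innerForm_self_nonneg (hG : MetricOn G U) (hy : y ∈ U)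
    (S : Coord n [⋀^Fin p]→L[ℝ] ℝ) : 0 ≤ innerForm (G y)⁻¹ S S := by
  obtain ⟨P, hP⟩ := hG.exists_frame hy
  rw [innerForm_eq_dotForm hP]
  exact dotForm_self_nonneg _

theorem hasFDerivAt_dotForm {S W : Coord n → Coord n [⋀^Fin p]→L[ℝ] ℝ}
    {S' W' : Coord n →L[ℝ] Coord n [⋀^Fin p]→L[ℝ] ℝ} (hS : HasFDerivAt S S' y)
    (hW : HasFDerivAt W W' y) : ∃ L : Coord n →L[ℝ] ℝ,
      HasFDerivAt (fun z => dotForm (S z) (W z)) L y ∧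
      ∀ v, L v = dotForm (S' v) (W y) + dotForm (S y) (W' v) := by
  refine ⟨_, HasFDerivAt.fun_sum fun I _ => HasFDerivAt.mul
    (hasFDerivAt_clm_comp (ContinuousAlternatingMap.apply ℝ (Coord n) ℝ fun a => stdVec (I a)) hS)
    (hasFDerivAt_clm_comp (ContinuousAlternatingMap.apply ℝ (Coord n) ℝ fun a => stdVec (I a)) hW),
    fun v => ?_⟩
  simp only [sum_apply, dotForm, ← Finset.sum_add_distrib]
  refine Finset.sum_congr rfl fun I _ => ?_
  simp
  ring

theorem dotForm_sub_right (S V W : Coord n [⋀^Fin p]→L[ℝ] ℝ) :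
    dotForm S (V - W) = dotForm S V - dotForm S W := by
  simp only [← dotFormL_apply, map_sub]

theorem dotForm_sub_left (S V W : Coord n [⋀^Fin p]→L[ℝ] ℝ) :
    dotForm (V - W) S = dotForm V S - dotForm W S := by
  rw [dotForm_comm, dotForm_sub_right, dotForm_comm, dotForm_comm S]

/-- The inner product of forms is parallel. -/
theorem MetricOn.fderiv_innerForm (hG : MetricOn G U) (hy : y ∈ U)
    {S W : Coord n → Coord n [⋀^Fin p]→L[ℝ] ℝ} (hS : DifferentiableAt ℝ S y)
    (hW : DifferentiableAt ℝ W y) (v : Coord n) :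
    fderiv ℝ (fun z => innerForm (G z)⁻¹ (S z) (W z)) y v =
      innerForm (G y)⁻¹ (nabla (gam G) S y v) (W y) +
      innerForm (G y)⁻¹ (S y) (nabla (gam G) W y v) := by
  obtain ⟨L, hL, hLv⟩ := hG.hasFDerivAt_raise hy hW
  obtain ⟨D, hD, hDv⟩ := hasFDerivAt_dotForm hS.hasFDerivAt hL
  have : (fun z => innerForm (G z)⁻¹ (S z) (W z)) = fun z => dotForm (S z) (raise G W z) := rfl
  rw [this, hD.fderiv, hDv, hLv, dotForm_sub_right, ← dotForm_act, nabla_apply (β := S), innerForm,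
    innerForm, dotForm_sub_left]
  simp only [raise]
  ring

/-- Restrict to a line. A positive second derivative would make the point also a local minimum, so
the function would be locally constant along the line and its second derivative zero. -/
theorem second_deriv_nonpos_of_isLocalMax {E : Type*} [NormedAddCommGroup E] [NormedSpace ℝ E]
    {u : E → ℝ} {y : E} (hu : ContDiffAt ℝ 2 u y) (hmax : IsLocalMax u y) (v : E) :
    fderiv ℝ (fun z => fderiv ℝ u z v) y v ≤ 0 := by
  set l : ℝ → E := fun t => y + t • v with hl
  have hl' : ∀ t, HasDerivAt l v t := fun t => by
    have := ((hasDerivAt_id t).smul_const v).const_add y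
    rwa [one_smul] at this
  have hl0 : l 0 = y := by simp [hl]
  have hlc : Filter.Tendsto l (nhds 0) (nhds y) := by
    have := (hl' 0).continuousAt.tendsto
    rwa [hl0] at this
  have hder : deriv (u ∘ l) =ᶠ[nhds 0] fun t => fderiv ℝ u (l t) v := by
    have h1 : ∀ᶠ z in nhds y, DifferentiableAt ℝ u z :=
      (hu.eventually (by simp)).mono fun z hz => hz.differentiableAt (by simp)
    filter_upwards [hlc.eventually h1] with t ht
    exact (ht.hasFDerivAt.comp_hasDerivAt t (hl' t)).deriv
  have hd2 : DifferentiableAt ℝ (fun z => fderiv ℝ u z v) y :=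
    ((hu.fderiv_right (m := 1) (by norm_num)).differentiableAt (by norm_num)).clm_apply
      (differentiableAt_const v)
  have hsecond : deriv (deriv (u ∘ l)) 0 = fderiv ℝ (fun z => fderiv ℝ u z v) y v := by
    rw [hder.deriv_eq]
    have h3 : HasFDerivAt (fun z => fderiv ℝ u z v) (fderiv ℝ (fun z => fderiv ℝ u z v) y) (l 0) := by
      rw [hl0]
      exact hd2.hasFDerivAt
    exact (h3.comp_hasDerivAt 0 (hl' 0)).deriv
  by_contra! hpos
  rw [← hsecond] at hpos
  have hmax' : IsLocalMax (u ∘ l) 0 := by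
    have : ∀ᶠ t in nhds (0 : ℝ), u (l t) ≤ u y := hlc.eventually hmax
    simpa [IsLocalMax, IsMaxFilter, hl0] using this
  have hcont : ContinuousAt (u ∘ l) 0 := by
    refine ContinuousAt.comp ?_ (hl' 0).continuousAt
    rw [hl0]
    exact hu.continuousAt
  have hmin := isLocalMin_of_deriv_deriv_pos hpos hmax'.deriv_eq_zero hcont
  have hconst : (u ∘ l) =ᶠ[nhds 0] fun _ => (u ∘ l) 0 := by
    filter_upwards [hmax', hmin] with t h1 h2
    exact le_antisymm h1 h2
  have : deriv (deriv (u ∘ l)) 0 = 0 := by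
    rw [hconst.deriv.deriv_eq]
    simp
  linarith

theorem innerForm_sub_left (A : Matrix (Fin n) (Fin n) ℝ) (S V W : Coord n [⋀^Fin p]→L[ℝ] ℝ) :
    innerForm A (V - W) S = innerForm A V S - innerForm A W S := dotForm_sub_left _ _ _

/-- The Bochner inequality at a maximum of `|β|²`. -/
theorem innerForm_hess_nonpos (hG : MetricOn G U) (hy : y ∈ U)
    {β : Coord n → Coord n [⋀^Fin p]→L[ℝ] ℝ} (hβ : ContDiffOn ℝ ∞ β U)
    (hmax : IsLocalMax (fun z => innerForm (G z)⁻¹ (β z) (β z)) y) (v : Coord n) :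
    innerForm (G y)⁻¹ (hess (gam G) β y v v) (β y) ≤ 0 := by
  have hβd : ∀ z ∈ U, DifferentiableAt ℝ β z := fun z hz =>
    (hβ.contDiffAt (hG.isOpen.mem_nhds hz)).differentiableAt (by simp)
  have hnb := hG.isOpen.mem_nhds hy
  have hΓ := hG.contDiffOn_gam.contDiffAt hnb
  have hnab : DifferentiableAt ℝ (nabla (gam G) β) y :=
    (contDiffAt_nabla (m := 1) (hΓ.of_le (by simp))
      ((hβ.contDiffAt hnb).of_le (by norm_num; exact ENat.LEInfty.out))).differentiableAt (by simp)
  have hu : ContDiffOn ℝ ∞ (fun z => innerForm (G z)⁻¹ (β z) (β z)) U :=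
    ContDiffOn.sum fun I _ =>
      ((ContinuousAlternatingMap.apply ℝ (Coord n) ℝ fun a => stdVec (I a)).contDiff.comp_contDiffOn
        hβ).mul (contDiffOn_raise_apply hG hβ I)
  have h1 : ∀ z ∈ U, ∀ w, fderiv ℝ (fun z => innerForm (G z)⁻¹ (β z) (β z)) z w =
      2 * innerForm (G z)⁻¹ (nabla (gam G) β z w) (β z) := by
    intro z hz w
    rw [hG.fderiv_innerForm hz (hβd z hz) (hβd z hz), hG.innerForm_comm hz (β z)]
    ring
  -- The first-order condition at the maximum disposes of the correction `∇β(Γ(v, v))` separating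
  -- `∇²β(v, v)` from an iterated derivative.
  have h0 : ∀ w, innerForm (G y)⁻¹ (nabla (gam G) β y w) (β y) = 0 := by
    intro w
    have := h1 y hy w
    rw [hmax.fderiv_eq_zero] at this
    simpa using this.symm
  have h2 := second_deriv_nonpos_of_isLocalMax
    ((hu.contDiffAt hnb).of_le ENat.LEInfty.out) hmax v
  have h3 : (fun z => fderiv ℝ (fun z => innerForm (G z)⁻¹ (β z) (β z)) z v) =ᶠ[nhds y]
      fun z => (2 : ℝ) * innerForm (G z)⁻¹ (nabla (gam G) β z v) (β z) :=
    Filter.eventually_of_mem hnb fun z hz => h1 z hz v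
  have hnv : HasFDerivAt (fun z => nabla (gam G) β z v)
      ((ContinuousLinearMap.apply ℝ (Coord n [⋀^Fin p]→L[ℝ] ℝ) v).comp
        (fderiv ℝ (nabla (gam G) β) y)) y :=
    hasFDerivAt_clm_comp (X := Coord n) (Y := Coord n →L[ℝ] Coord n [⋀^Fin p]→L[ℝ] ℝ)
      (Z := Coord n [⋀^Fin p]→L[ℝ] ℝ) (ContinuousLinearMap.apply ℝ _ v) hnab.hasFDerivAt
  have h4 : nabla (gam G) (fun z => nabla (gam G) β z v) y v =
      hess (gam G) β y v v + nabla (gam G) β y (gam G y v v) := by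
    rw [nabla_apply, hnv.fderiv, hess_apply, sub_add_cancel]
    rfl
  have hd : DifferentiableAt ℝ (fun z => innerForm (G z)⁻¹ (nabla (gam G) β z v) (β z)) y := by
    obtain ⟨L, hL, -⟩ := hG.hasFDerivAt_raise hy (hβd y hy)
    obtain ⟨D, hD, -⟩ := hasFDerivAt_dotForm hnv hL
    exact hD.differentiableAt
  have h6 : hess (gam G) β y v v = nabla (gam G) (fun z => nabla (gam G) β z v) y v -
      nabla (gam G) β y (gam G y v v) := by rw [h4, add_sub_cancel_right]
  rw [h3.fderiv_eq, fderiv_const_mul hd, smul_apply,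
    hG.fderiv_innerForm hy hnv.differentiableAt (hβd y hy)] at h2
  rw [h6, innerForm_sub_left, h0]
  -- Half the second derivative of `|β|²` along `v` is `⟨∇ᵥ(∇ᵥβ), β⟩ + |∇ᵥβ|²`; the square has the
  -- helpful sign.
  have h5 := hG.innerForm_self_nonneg hy (nabla (gam G) β y v)
  simp only [smul_eq_mul] at h2
  linarith

end Bochner

/-! ### The Weitzenböck formula -/

section Weitzenboeck

variable {n p : ℕ} {G : Coord n → Matrix (Fin n) (Fin n) ℝ} {U : Set (Coord n)} {y : Coord n}

open ContinuousAlternatingMap in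
/-- Covariant derivative of the contracted covariant derivative `-gⁱʲ ∇ᵢβ(∂ⱼ, ·)`. -/
theorem nabla_codifferential (hG : MetricOn G U) (hy : y ∈ U)
    {β : Coord n → Coord n [⋀^Fin (p + 1)]→L[ℝ] ℝ} {η : Coord n → Coord n [⋀^Fin p]→L[ℝ] ℝ}
    (hβ : ContDiffOn ℝ ∞ β U)
    (hη : ∀ z ∈ U, η z =
      - ∑ i, (nabla (gam G) β z (stdVec i)).curryLeft (toOp (G z)⁻¹ (stdVec i))) (v : Coord n) :
    nabla (gam G) η y v =
      - ∑ i, (hess (gam G) β y v (stdVec i)).curryLeft (toOp (G y)⁻¹ (stdVec i)) := by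
  have hnb := hG.isOpen.mem_nhds hy
  have hβ2 : ContDiffAt ℝ 2 β y := (hβ.contDiffAt hnb).of_le ENat.LEInfty.out
  have hΓ1 : ContDiffAt ℝ 1 (gam G) y := (hG.contDiffOn_gam.contDiffAt hnb).of_le ENat.LEInfty.out
  have hnab : DifferentiableAt ℝ (nabla (gam G) β) y :=
    (contDiffAt_nabla (m := 1) hΓ1 (by norm_num; exact hβ2)).differentiableAt (by simp)
  obtain ⟨A', hA', hA'v⟩ := hG.hasFDerivAt_toOp_inv hy
  set c : Fin n → Coord n → Coord n [⋀^Fin p]→L[ℝ] ℝ := fun i z =>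
    (nabla (gam G) β z (stdVec i)).curryLeft (toOp (G z)⁻¹ (stdVec i)) with hc
  have hw : ∀ i, HasFDerivAt (fun z => toOp (G z)⁻¹ (stdVec i)) (A'.flip (stdVec i)) y := by
    intro i
    exact hasFDerivAt_clm_comp (ContinuousLinearMap.apply ℝ (Coord n) (stdVec i)) hA'
  have hnv : ∀ i, HasFDerivAt (fun z => nabla (gam G) β z (stdVec i))
      ((ContinuousLinearMap.apply ℝ (Coord n [⋀^Fin (p + 1)]→L[ℝ] ℝ) (stdVec i)).comp
        (fderiv ℝ (nabla (gam G) β) y)) y := fun i =>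
    hasFDerivAt_clm_comp (X := Coord n) (Y := Coord n →L[ℝ] Coord n [⋀^Fin (p + 1)]→L[ℝ] ℝ)
      (Z := Coord n [⋀^Fin (p + 1)]→L[ℝ] ℝ) (ContinuousLinearMap.apply ℝ _ (stdVec i))
      hnab.hasFDerivAt
  have hcd : ∀ i, DifferentiableAt ℝ (c i) y := fun i =>
    ((hasFDerivAt_clm_comp (X := Coord n) (Y := Coord n [⋀^Fin (p + 1)]→L[ℝ] ℝ)
      (Z := Coord n →L[ℝ] Coord n [⋀^Fin p]→L[ℝ] ℝ)
      (curryLeftLI (𝕜 := ℝ) (E := Coord n) (F := ℝ) (n := p)).toContinuousLinearMap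
      (hnv i)).clm_apply (hw i)).differentiableAt
  have hη' : η =ᶠ[nhds y] fun z => - ∑ i, c i z := Filter.eventually_of_mem hnb hη
  have hfd : fderiv ℝ η y v = - ∑ i, fderiv ℝ (c i) y v := by
    have h : HasFDerivAt (fun z => - ∑ i, c i z) (- ∑ i, fderiv ℝ (c i) y) y :=
      (HasFDerivAt.fun_sum fun i _ => (hcd i).hasFDerivAt).fun_neg
    rw [hη'.fderiv_eq, h.fderiv, _root_.neg_apply, _root_.sum_apply]
  have hci : ∀ i, nabla (gam G) (c i) y v =
      (hess (gam G) β y v (stdVec i)).curryLeft (toOp (G y)⁻¹ (stdVec i))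
      + (nabla (gam G) β y (gam G y v (stdVec i))).curryLeft (toOp (G y)⁻¹ (stdVec i))
      - (nabla (gam G) β y (stdVec i)).curryLeft
          (toOp (G y)⁻¹ (ContinuousLinearMap.adjoint (gam G y v) (stdVec i))) := by
    intro i
    have h1 : nabla (gam G) (fun z => nabla (gam G) β z (stdVec i)) y v =
        hess (gam G) β y v (stdVec i) + nabla (gam G) β y (gam G y v (stdVec i)) := by
      rw [nabla_apply, (hnv i).fderiv, hess_apply, sub_add_cancel]
      rfl
    have h2 : A'.flip (stdVec i) v + gam G y v (toOp (G y)⁻¹ (stdVec i)) =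
        - toOp (G y)⁻¹ (ContinuousLinearMap.adjoint (gam G y v) (stdVec i)) := by
      rw [ContinuousLinearMap.flip_apply, hA'v]
      simp
    rw [hc, nabla_curryLeft (hnv i).differentiableAt (hw i), h1, h2, map_neg, curryLeft_add,
      _root_.add_apply, ← sub_eq_add_neg]
  -- The contraction commutes with `∇`: the `Γ` term from the index of `∇ᵢβ` and the `Γᵀ` term from
  -- `g⁻¹` agree after transposing inside the trace.
  have htr := sum_bilin_adjoint (LinearMap.mk₂ ℝ
    (fun u w => (nabla (gam G) β y u).curryLeft (toOp (G y)⁻¹ w))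
    (by intros; simp) (by intros; simp) (by intros; simp) (by intros; simp)) (gam G y v)
  simp only [LinearMap.mk₂_apply] at htr
  rw [nabla_apply, hfd, hη y hy, map_neg, _root_.map_sum, _root_.neg_apply, _root_.sum_apply, sub_neg_eq_add,
    neg_add_eq_sub, ← neg_sub, ← Finset.sum_sub_distrib]
  have : ∀ i, fderiv ℝ (c i) y v - act (c i y) (gam G y v) = nabla (gam G) (c i) y v :=
    fun i => rfl
  simp only [hc] at this
  simp only [hc, this]
  simp only [hc] at hci
  simp only [hci]
  rw [Finset.sum_sub_distrib, Finset.sum_add_distrib, htr, add_sub_cancel_right]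

open ContinuousAlternatingMap in
/-- The Weitzenböck formula for the Laplace-Beltrami operator on forms. -/
theorem IsLaplaceBeltrami.apply_eq (hG : MetricOn G U) (hy : y ∈ U)
    {β ζ : Coord n → Coord n [⋀^Fin (p + 1)]→L[ℝ] ℝ} (hβ : ContDiffOn ℝ ∞ β U)
    (h : IsLaplaceBeltrami G U β ζ) (x : Fin (p + 1) → Coord n) :
    ζ y x = ∑ i, hess (gam G) β y (stdVec i) (toOp (G y)⁻¹ (stdVec i)) x -
      ∑ a : Fin (p + 1), ∑ i, (-1 : ℤ) ^ (a : ℕ) • act (β y) (curvOp (gam G) y (x a) (stdVec i))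
        (Matrix.vecCons (toOp (G y)⁻¹ (stdVec i)) (a.removeNth x)) := by
  obtain ⟨η, θ, hη, hθ, hζ⟩ := h
  have hnb := hG.isOpen.mem_nhds hy
  have hdβ : ContDiffOn ℝ ∞ (extDeriv β) U :=
    (alternatizeUncurryFinCLM ℝ (Coord n) ℝ).contDiff.comp_contDiffOn
      (hβ.fderiv_of_isOpen hG.isOpen (by simp))
  have hβ2 : ContDiffAt ℝ 2 β y := (hβ.contDiffAt hnb).of_le ENat.LEInfty.out
  have hΓ1 : ContDiffAt ℝ 1 (gam G) y := (hG.contDiffOn_gam.contDiffAt hnb).of_le ENat.LEInfty.out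
  have hΓs : ∀ᶠ z in nhds y, ∀ u v, gam G z u v = gam G z v u :=
    Filter.eventually_of_mem hnb fun z hz u v => hG.gam_symm hz u v
  -- `d d*` yields second derivatives in the order (free index, contracted index). The sum from `d*
  -- d` below has the opposite order, together with the rough Laplacian, so the difference is a
  -- commutator, that is, curvature.
  have h1 : extDeriv η y x = - ∑ a : Fin (p + 1), ∑ i, (-1 : ℤ) ^ (a : ℕ) •
      hess (gam G) β y (x a) (stdVec i)
        (Matrix.vecCons (toOp (G y)⁻¹ (stdVec i)) (a.removeNth x)) := by
    rw [extDeriv_eq_alternatize_nabla fun u v => hG.gam_symm hy u v, alternatizeUncurryFin_apply,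
      ← Finset.sum_neg_distrib]
    refine Finset.sum_congr rfl fun a _ => ?_
    rw [nabla_codifferential hG hy hβ fun z hz => hη.eq_neg_sum hG hβ hz,
      ContinuousAlternatingMap.neg_apply, smul_neg,
      ContinuousAlternatingMap.sum_apply, Finset.smul_sum]
    simp only [curryLeft_apply_apply]
  have h2 : θ y x = - ∑ i, hess (gam G) β y (stdVec i) (toOp (G y)⁻¹ (stdVec i)) x +
      ∑ a : Fin (p + 1), ∑ i, (-1 : ℤ) ^ (a : ℕ) • hess (gam G) β y (stdVec i) (x a)
        (Matrix.vecCons (toOp (G y)⁻¹ (stdVec i)) (a.removeNth x)) := by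
    rw [hθ.eq_neg_sum hG hdβ hy, ContinuousAlternatingMap.neg_apply, ContinuousAlternatingMap.sum_apply,
      Finset.sum_comm, ← Finset.sum_neg_distrib, ← Finset.sum_neg_distrib,
      ← Finset.sum_add_distrib]
    refine Finset.sum_congr rfl fun i _ => ?_
    rw [nabla_extDeriv hΓs hΓ1 hβ2, curryLeft_alternatizeUncurryFin,
      ContinuousAlternatingMap.sub_apply, alternatizeUncurryFin_apply, neg_sub, sub_eq_neg_add]
    rfl
  have hR : ∀ a i, act (β y) (curvOp (gam G) y (x a) (stdVec i))
        (Matrix.vecCons (toOp (G y)⁻¹ (stdVec i)) (a.removeNth x)) =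
      hess (gam G) β y (stdVec i) (x a)
        (Matrix.vecCons (toOp (G y)⁻¹ (stdVec i)) (a.removeNth x)) -
      hess (gam G) β y (x a) (stdVec i)
        (Matrix.vecCons (toOp (G y)⁻¹ (stdVec i)) (a.removeNth x)) := by
    intro a i
    have := hess_sub_hess (β := β) (fun u v => hG.gam_symm hy u v)
      (hΓ1.differentiableAt (by simp)) hβ2 (stdVec i) (x a)
    rw [← ContinuousAlternatingMap.sub_apply, this]
    have hc : curvOp (gam G) y (x a) (stdVec i) = - curvOp (gam G) y (stdVec i) (x a) := by
      simp only [curvOp]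
      abel
    rw [hc, map_neg]
  rw [hζ y hy, ContinuousAlternatingMap.neg_apply, ContinuousAlternatingMap.add_apply, h1, h2]
  simp only [hR, smul_sub, Finset.sum_sub_distrib]
  ring

end Weitzenboeck

/-! ### Components and traces in a frame -/

section Frame

variable {n p : ℕ}

/-- The components of a covariant tensor in the frame given by the columns of `P`. -/
def pull (P : Matrix (Fin n) (Fin n) ℝ) (T : (Fin p → Fin n) → ℝ) (I : Fin p → Fin n) : ℝ :=
  ∑ J : Fin p → Fin n, (∏ a, P (J a) (I a)) * T J

theorem tensorInner_mul_transpose (P : Matrix (Fin n) (Fin n) ℝ) (T U : (Fin p → Fin n) → ℝ) :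
    tensorInner (P * P.transpose) T U = ∑ I, pull P T I * pull P U I := by
  have h : ∀ I J : Fin p → Fin n, ∏ a, (P * P.transpose) (I a) (J a) =
      ∑ K : Fin p → Fin n, (∏ a, P (I a) (K a)) * ∏ a, P (J a) (K a) := by
    intro I J
    simp only [Matrix.mul_apply, Matrix.transpose_apply, ← Finset.prod_mul_distrib]
    rw [Finset.prod_univ_sum, Fintype.piFinset_univ]
  simp only [tensorInner, pull, h, Finset.sum_mul, Finset.mul_sum]
  conv_lhs =>
    rw [Finset.sum_comm]
    enter [2, J]
    rw [Finset.sum_comm]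
  rw [Finset.sum_comm]
  refine Finset.sum_congr rfl fun K _ => Finset.sum_congr rfl fun I _ =>
    Finset.sum_congr rfl fun J _ => ?_
  ring

/-- In an orthonormal frame the norm is the root of a sum of squares, so it dominates each
component. This is how bounds on norms enter the estimates. -/
theorem abs_pull_le (P : Matrix (Fin n) (Fin n) ℝ) (T : (Fin p → Fin n) → ℝ)
    (I : Fin p → Fin n) : |pull P T I| ≤ tensorNorm (P * P.transpose) T := by
  rw [tensorNorm, tensorInner_mul_transpose, ← Real.sqrt_sq_eq_abs]
  refine Real.sqrt_le_sqrt ?_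
  rw [sq]
  exact Finset.single_le_sum (f := fun I => pull P T I * pull P T I)
    (fun I _ => mul_self_nonneg _) (Finset.mem_univ I)

theorem multilinear_toOp_stdVec {V : Type*} [AddCommGroup V] [Module ℝ V]
    (φ : MultilinearMap ℝ (fun _ : Fin p => Coord n) V) (P : Matrix (Fin n) (Fin n) ℝ)
    (I : Fin p → Fin n) : φ (fun a => toOp P (stdVec (I a))) =
      ∑ J : Fin p → Fin n, (∏ a, P (J a) (I a)) • φ (fun a => stdVec (J a)) := by
  simp only [toOp_stdVec]
  rw [φ.map_sum]
  exact Finset.sum_congr rfl fun J _ => φ.map_smul_univ _ _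

theorem bilin_toOp_stdVec {V : Type*} [AddCommGroup V] [Module ℝ V]
    (b : Coord n →ₗ[ℝ] Coord n →ₗ[ℝ] V) (P : Matrix (Fin n) (Fin n) ℝ) (c d : Fin n) :
    b (toOp P (stdVec c)) (toOp P (stdVec d)) =
      ∑ i, ∑ j, (P i c * P j d) • b (stdVec i) (stdVec j) := by
  simp only [toOp_stdVec, map_sum, LinearMap.sum_apply, map_smul, LinearMap.smul_apply, mul_smul,
    Finset.smul_sum]
  rw [Finset.sum_comm]
  exact Finset.sum_congr rfl fun i _ => Finset.sum_congr rfl fun j _ => smul_comm _ _ _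

theorem sum_bilin_frame {V : Type*} [AddCommGroup V] [Module ℝ V]
    (b : Coord n →ₗ[ℝ] Coord n →ₗ[ℝ] V) {P A : Matrix (Fin n) (Fin n) ℝ}
    (hP : P * P.transpose = A) :
    ∑ c, b (toOp P (stdVec c)) (toOp P (stdVec c)) =
      ∑ i, ∑ j, A i j • b (stdVec i) (stdVec j) := by
  simp only [bilin_toOp_stdVec, ← hP, Matrix.mul_apply, Matrix.transpose_apply, Finset.sum_smul]
  rw [Finset.sum_comm]
  exact Finset.sum_congr rfl fun i _ => Finset.sum_comm

/-- A metric trace may be taken either with one raised index or in an orthonormal frame; this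
carries the Weitzenböck terms to the frame. -/
theorem sum_bilin_toOp {V : Type*} [AddCommGroup V] [Module ℝ V]
    (b : Coord n →ₗ[ℝ] Coord n →ₗ[ℝ] V) {P A : Matrix (Fin n) (Fin n) ℝ}
    (hP : P * P.transpose = A) :
    ∑ i, b (stdVec i) (toOp A (stdVec i)) =
      ∑ c, b (toOp P (stdVec c)) (toOp P (stdVec c)) := by
  rw [sum_bilin_frame b hP]
  have hA : A.transpose = A := by
    rw [← hP, Matrix.transpose_mul, Matrix.transpose_transpose]
  refine Finset.sum_congr rfl fun i _ => ?_
  rw [toOp_stdVec, map_sum]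
  refine Finset.sum_congr rfl fun j _ => ?_
  rw [map_smul, ← hA, Matrix.transpose_apply, hA]

end Frame

/-! ### The Riemann and Ricci tensors in an orthonormal frame -/

section Riemann

variable {n : ℕ} {G : Coord n → Matrix (Fin n) (Fin n) ℝ} {U : Set (Coord n)} {y : Coord n}

theorem curvOp_add_left (Γ : Coord n → Coord n →L[ℝ] Coord n →L[ℝ] Coord n) (u u' v : Coord n) :
    curvOp Γ y (u + u') v = curvOp Γ y u v + curvOp Γ y u' v := by
  simp only [curvOp, map_add, _root_.add_apply, ContinuousLinearMap.comp_add,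
    ContinuousLinearMap.add_comp]
  abel

theorem curvOp_add_right (Γ : Coord n → Coord n →L[ℝ] Coord n →L[ℝ] Coord n) (u v v' : Coord n) :
    curvOp Γ y u (v + v') = curvOp Γ y u v + curvOp Γ y u v' := by
  simp only [curvOp, map_add, _root_.add_apply, ContinuousLinearMap.comp_add,
    ContinuousLinearMap.add_comp]
  abel

theorem curvOp_smul_left (Γ : Coord n → Coord n →L[ℝ] Coord n →L[ℝ] Coord n) (c : ℝ)
    (u v : Coord n) : curvOp Γ y (c • u) v = c • curvOp Γ y u v := by
  simp only [curvOp, map_smul, _root_.smul_apply, ContinuousLinearMap.comp_smul,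
    ContinuousLinearMap.smul_comp, smul_add, smul_sub]

theorem curvOp_smul_right (Γ : Coord n → Coord n →L[ℝ] Coord n →L[ℝ] Coord n) (c : ℝ)
    (u v : Coord n) : curvOp Γ y u (c • v) = c • curvOp Γ y u v := by
  simp only [curvOp, map_smul, _root_.smul_apply, ContinuousLinearMap.comp_smul,
    ContinuousLinearMap.smul_comp, smul_add, smul_sub]

theorem MetricOn.curvOp_stdVec (hG : MetricOn G U) (hy : y ∈ U) (i j l p : Fin n) :
    curvOp (gam G) y (stdVec i) (stdVec j) (stdVec l) p = curvUp G i j l p y := by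
  have hd : DifferentiableAt ℝ (gam G) y :=
    (hG.contDiffOn_gam.contDiffAt (hG.isOpen.mem_nhds hy)).differentiableAt (by simp)
  have hc : ∀ i j l, fderiv ℝ (gam G) y (stdVec i) (stdVec j) (stdVec l) p =
      pd i (christoffel G p j l) y := by
    intro i j l
    have h1 := ((hd.hasFDerivAt.clm_apply (hasFDerivAt_const (stdVec j) y)).clm_apply
      (hasFDerivAt_const (stdVec l : Coord n) y))
    have h2 := hasFDerivAt_clm_comp (X := Coord n) (Y := Coord n) (Z := ℝ)
      (EuclideanSpace.proj p) h1
    have h3 : (fun z => (EuclideanSpace.proj p : Coord n →L[ℝ] ℝ)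
        (gam G z (stdVec j) (stdVec l))) = christoffel G p j l := by
      funext z
      rw [gam_stdVec_stdVec, map_sum]
      simp [stdVec_apply]
    rw [h3] at h2
    rw [pd, h2.fderiv]
    simp
  have hg : ∀ i j l, gam G y (stdVec i) (gam G y (stdVec j) (stdVec l)) p =
      ∑ q, christoffel G q j l y * christoffel G p i q y := by
    intro i j l
    rw [gam_stdVec_stdVec G y j l, map_sum]
    simp [gam_stdVec_stdVec, stdVec_apply]
  have : curvOp (gam G) y (stdVec i) (stdVec j) (stdVec l) p =
      fderiv ℝ (gam G) y (stdVec i) (stdVec j) (stdVec l) p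
      - fderiv ℝ (gam G) y (stdVec j) (stdVec i) (stdVec l) p
      + gam G y (stdVec i) (gam G y (stdVec j) (stdVec l)) p
      - gam G y (stdVec j) (gam G y (stdVec i) (stdVec l)) p := rfl
  rw [this, hc, hc, hg, hg, curvUp, Finset.sum_sub_distrib]
  ring

variable (G y) in
/-- The Riemann tensor `(u, v, w, z) ↦ g(R(u, v)z, w)`. -/
def riemForm : MultilinearMap ℝ (fun _ : Fin 4 => Coord n) ℝ where
  toFun x := inner ℝ (toOp (G y) (curvOp (gam G) y (x 0) (x 1) (x 3))) (x 2)
  map_update_add' := by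
    intro inst m i u v
    obtain rfl : inst = instDecidableEqFin 4 := Subsingleton.elim _ _
    fin_cases i <;>
      simp [curvOp_add_left, curvOp_add_right, inner_add_left, inner_add_right]
  map_update_smul' := by
    intro inst m i c u
    obtain rfl : inst = instDecidableEqFin 4 := Subsingleton.elim _ _
    fin_cases i <;>
      simp [curvOp_smul_left, curvOp_smul_right, inner_smul_left, inner_smul_right]

theorem riemForm_apply (x : Fin 4 → Coord n) : riemForm G y x =
    inner ℝ (toOp (G y) (curvOp (gam G) y (x 0) (x 1) (x 3))) (x 2) := rfl

theorem MetricOn.riemForm_stdVec (hG : MetricOn G U) (hy : y ∈ U) (I : Fin 4 → Fin n) :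
    riemForm G y (fun a => stdVec (I a)) = riem G (I 0) (I 1) (I 2) (I 3) y := by
  rw [riemForm_apply, real_inner_comm, inner_stdVec, toOp_apply, riem]
  simp only [hG.curvOp_stdVec hy]

variable {P : Matrix (Fin n) (Fin n) ℝ}

theorem MetricOn.abs_riemForm_le (hG : MetricOn G U) (hy : y ∈ U)
    (hP : P * P.transpose = (G y)⁻¹) (I : Fin 4 → Fin n) :
    |riemForm G y fun a => toOp P (stdVec (I a))| ≤ tensorNorm (G y)⁻¹
      (fun I : Fin 4 → Fin n => riem G (I 0) (I 1) (I 2) (I 3) y) := by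
  rw [multilinear_toOp_stdVec, ← hP]
  simp only [hG.riemForm_stdVec hy]
  exact abs_pull_le P (fun I : Fin 4 → Fin n => riem G (I 0) (I 1) (I 2) (I 3) y) I

theorem MetricOn.sum_inner_frame (hG : MetricOn G U) (hy : y ∈ U)
    (hP : P * P.transpose = (G y)⁻¹) (v : Coord n) :
    ∑ c, inner ℝ (toOp (G y) v) (toOp P (stdVec c)) • toOp P (stdVec c) = v := by
  have h : ∀ c, inner ℝ (toOp (G y) v) (toOp P (stdVec c)) =
      (toOp P.transpose (toOp (G y) v)) c := by
    intro c
    rw [toOp_transpose, ← inner_stdVec, ContinuousLinearMap.adjoint_inner_right, real_inner_comm]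
  simp only [h, ← map_smul, ← map_sum, sum_smul_stdVec]
  have h2 : toOp P (toOp P.transpose (toOp (G y) v)) = toOp (P * P.transpose * G y) v := by
    rw [toOp_mul, toOp_mul]
    rfl
  rw [h2, hP, Matrix.nonsing_inv_mul _ (hG.isUnit_det hy), toOp_one]
  rfl

/-- The matrix entries of the curvature operator in the frame are components of `Rm`, hence bounded
by `|Rm|`. -/
theorem MetricOn.curvOp_frame (hG : MetricOn G U) (hy : y ∈ U)
    (hP : P * P.transpose = (G y)⁻¹) (a b d : Fin n) :
    curvOp (gam G) y (toOp P (stdVec a)) (toOp P (stdVec b)) (toOp P (stdVec d)) =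
      ∑ c, riemForm G y (fun s => toOp P (stdVec (![a, b, c, d] s))) • toOp P (stdVec c) := by
  conv_lhs => rw [← hG.sum_inner_frame hy hP (curvOp (gam G) y _ _ _)]
  rfl

/-- In the frame, a Ricci component is a sum of `n` components of `Rm`, each bounded by `|Rm|`. -/
theorem MetricOn.abs_sum_ricci_le (hG : MetricOn G U) (hy : y ∈ U)
    (hP : P * P.transpose = (G y)⁻¹) (d a : Fin n) :
    |∑ i, ∑ j, P i d * P j a * ricci G i j y| ≤ n * tensorNorm (G y)⁻¹
      (fun I : Fin 4 → Fin n => riem G (I 0) (I 1) (I 2) (I 3) y) := by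
  set K := tensorNorm (G y)⁻¹ (fun I : Fin 4 → Fin n => riem G (I 0) (I 1) (I 2) (I 3) y)
  have h1 : ∀ i j, ricci G i j y = ∑ c, riemForm G y
      ![stdVec i, toOp P (stdVec c), stdVec j, toOp P (stdVec c)] := by
    intro i j
    have : ∑ c, riemForm G y ![stdVec i, toOp P (stdVec c), stdVec j, toOp P (stdVec c)] =
        ∑ k, ∑ l, (G y)⁻¹ k l • riemForm G y ![stdVec i, stdVec k, stdVec j, stdVec l] :=
      sum_bilin_frame (LinearMap.mk₂ ℝ
      (fun v z => riemForm G y ![stdVec i, v, stdVec j, z])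
      (by intros; simp [riemForm_apply, curvOp_add_right, inner_add_left])
      (by intros; simp [riemForm_apply, curvOp_smul_right, inner_smul_left])
      (by intros; simp [riemForm_apply, inner_add_left])
      (by intros; simp [riemForm_apply, inner_smul_left])) hP
    rw [this, ricci]
    refine Finset.sum_congr rfl fun k _ => Finset.sum_congr rfl fun l _ => ?_
    have h2 : ![stdVec i, stdVec k, stdVec j, stdVec l] =
        fun s => (stdVec (![i, k, j, l] s) : Coord n) := by
      funext s
      fin_cases s <;> rfl
    rw [h2, hG.riemForm_stdVec hy]
    rfl
  have h3 : ∑ i, ∑ j, P i d * P j a * ricci G i j y = ∑ c, riemForm G y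
      (fun s => toOp P (stdVec (![d, c, a, c] s))) := by
    have : ∑ c, riemForm G y ![toOp P (stdVec d), toOp P (stdVec c), toOp P (stdVec a),
          toOp P (stdVec c)] = ∑ i, ∑ j, (P i d * P j a) • ∑ c, riemForm G y
            ![stdVec i, toOp P (stdVec c), stdVec j, toOp P (stdVec c)] :=
      bilin_toOp_stdVec (LinearMap.mk₂ ℝ
      (fun v z => ∑ c, riemForm G y ![v, toOp P (stdVec c), z, toOp P (stdVec c)])
      (by intros; simp [riemForm_apply, curvOp_add_left, inner_add_left, Finset.sum_add_distrib])
      (by intros; simp [riemForm_apply, curvOp_smul_left, inner_smul_left, Finset.mul_sum])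
      (by intros; simp [riemForm_apply, inner_add_right, Finset.sum_add_distrib])
      (by intros; simp [riemForm_apply, inner_smul_right, Finset.mul_sum])) P d a
    simp only [h1]
    refine this.symm.trans ?_
    refine Finset.sum_congr rfl fun c _ => congrArg _ ?_
    funext s
    fin_cases s <;> rfl
  rw [h3]
  refine (Finset.abs_sum_le_sum_abs _ _).trans ?_
  refine (Finset.sum_le_sum fun c _ => hG.abs_riemForm_le hy hP _).trans ?_
  simp [K]

end Riemann

/-! ### Pointwise estimates by counting components -/

section Estimate

variable {n p : ℕ} {A P : Matrix (Fin n) (Fin n) ℝ}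

theorem innerForm_eq_sum (hP : P * P.transpose = A) (S W : Coord n [⋀^Fin p]→L[ℝ] ℝ) :
    innerForm A S W = ∑ I : Fin p → Fin n,
      S (fun a => toOp P (stdVec (I a))) * W (fun a => toOp P (stdVec (I a))) :=
  innerForm_eq_dotForm hP S W

theorem innerForm_self_nonneg_of_frame (hP : P * P.transpose = A)
    (S : Coord n [⋀^Fin p]→L[ℝ] ℝ) : 0 ≤ innerForm A S S := by
  rw [innerForm_eq_sum hP]
  exact Finset.sum_nonneg fun _ _ => mul_self_nonneg _

theorem abs_apply_frame_le (hP : P * P.transpose = A) (S : Coord n [⋀^Fin p]→L[ℝ] ℝ)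
    (I : Fin p → Fin n) : |S fun a => toOp P (stdVec (I a))| ≤ √(innerForm A S S) := by
  rw [innerForm_eq_sum hP, ← Real.sqrt_sq_eq_abs]
  refine Real.sqrt_le_sqrt ?_
  rw [sq]
  exact Finset.single_le_sum
    (f := fun I : Fin p → Fin n => S (fun a => toOp P (stdVec (I a))) *
      S (fun a => toOp P (stdVec (I a)))) (fun I _ => mul_self_nonneg _) (Finset.mem_univ I)

theorem act_frame_eq_sum (S : Coord n [⋀^Fin p]→L[ℝ] ℝ) {M : Coord n →L[ℝ] Coord n}
    {m : Fin n → Fin n → ℝ}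
    (hM : ∀ d, M (toOp P (stdVec d)) = ∑ c, m c d • toOp P (stdVec c)) (I : Fin p → Fin n) :
    act S M (fun a => toOp P (stdVec (I a))) =
      ∑ b, ∑ c, m c (I b) * S fun a => toOp P (stdVec (Function.update I b c a)) := by
  rw [act_apply]
  refine Finset.sum_congr rfl fun b _ => ?_
  rw [hM, map_update_smul_sum]
  refine Finset.sum_congr rfl fun c _ => ?_
  congr 2
  funext a
  rcases eq_or_ne a b with rfl | h <;> simp [*]

/-- There are `p` slots and, in each, `n` summands, each a matrix entry times a component of `S`. -/
theorem abs_act_frame_le (hP : P * P.transpose = A) (S : Coord n [⋀^Fin p]→L[ℝ] ℝ)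
    {M : Coord n →L[ℝ] Coord n} {m : Fin n → Fin n → ℝ} {K : ℝ} (hK : 0 ≤ K)
    (hM : ∀ d, M (toOp P (stdVec d)) = ∑ c, m c d • toOp P (stdVec c))
    (hm : ∀ c d, |m c d| ≤ K) (I : Fin p → Fin n) :
    |act S M (fun a => toOp P (stdVec (I a)))| ≤ p * n * K * √(innerForm A S S) := by
  rw [act_frame_eq_sum S hM]
  have h : ∀ b c, |m c (I b) * S fun a => toOp P (stdVec (Function.update I b c a))| ≤
      K * √(innerForm A S S) := by
    intro b c
    rw [abs_mul]
    exact mul_le_mul (hm _ _) (abs_apply_frame_le hP S _) (abs_nonneg _) hK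
  calc _ ≤ ∑ b : Fin p, ∑ c : Fin n, K * √(innerForm A S S) :=
        (Finset.abs_sum_le_sum_abs _ _).trans <| Finset.sum_le_sum fun b _ =>
          (Finset.abs_sum_le_sum_abs _ _).trans <| Finset.sum_le_sum fun c _ => h b c
    _ = _ := by
      simp only [Finset.sum_const, Finset.card_univ, Fintype.card_fin, nsmul_eq_mul]
      ring

theorem innerForm_le_of_abs_le (hP : P * P.transpose = A) (S W : Coord n [⋀^Fin p]→L[ℝ] ℝ)
    {B : ℝ} (h : ∀ I : Fin p → Fin n,
      |W fun a => toOp P (stdVec (I a))| ≤ B * √(innerForm A S S)) :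
    innerForm A W S ≤ n ^ p * B * innerForm A S S := by
  rw [innerForm_eq_sum hP]
  have h0 : 0 ≤ innerForm A S S := innerForm_self_nonneg_of_frame hP S
  calc _ ≤ ∑ I : Fin p → Fin n, B * innerForm A S S := by
        refine Finset.sum_le_sum fun I _ => ?_
        calc _ ≤ |(W fun a => toOp P (stdVec (I a))) * S fun a => toOp P (stdVec (I a))| :=
              le_abs_self _
          _ ≤ (B * √(innerForm A S S)) * √(innerForm A S S) := by
            rw [abs_mul]
            exact mul_le_mul (h I) (abs_apply_frame_le hP S I) (abs_nonneg _)
              ((abs_nonneg _).trans (h I))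
          _ = _ := by rw [mul_assoc, Real.mul_self_sqrt h0]
    _ = _ := by
      simp only [Finset.sum_const, Finset.card_univ, Fintype.card_pi, Fintype.card_fin,
        Finset.prod_const, nsmul_eq_mul]
      push_cast
      ring

variable {G : Coord n → Matrix (Fin n) (Fin n) ℝ} {U : Set (Coord n)} {y : Coord n}

/-- At a maximum of `|β|²`, `⟨□β, β⟩` is bounded by the curvature term of the Weitzenböck
formula. -/
theorem IsLaplaceBeltrami.innerForm_le (hG : MetricOn G U) (hy : y ∈ U)
    {β ζ : Coord n → Coord n [⋀^Fin (p + 1)]→L[ℝ] ℝ} (hβ : ContDiffOn ℝ ∞ β U)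
    (h : IsLaplaceBeltrami G U β ζ)
    (hmax : IsLocalMax (fun z => innerForm (G z)⁻¹ (β z) (β z)) y) {K : ℝ}
    (hK : tensorNorm (G y)⁻¹
      (fun I : Fin 4 → Fin n => riem G (I 0) (I 1) (I 2) (I 3) y) ≤ K) :
    innerForm (G y)⁻¹ (ζ y) (β y) ≤
      n ^ (p + 1) * ((p + 1) ^ 2 * n ^ 2 * K) * innerForm (G y)⁻¹ (β y) (β y) := by
  obtain ⟨P, hP⟩ := hG.exists_frame hy
  have hK0 : 0 ≤ K := (Real.sqrt_nonneg _).trans hK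
  set S := ∑ l, hess (gam G) β y (toOp P (stdVec l)) (toOp P (stdVec l)) with hS
  -- The rough Laplacian is the sum of second derivatives along the frame vectors, so the Bochner
  -- inequality applies to each summand.
  have hS0 : innerForm (G y)⁻¹ S (β y) ≤ 0 := by
    have : innerForm (G y)⁻¹ S (β y) = ∑ l, innerForm (G y)⁻¹
        (hess (gam G) β y (toOp P (stdVec l)) (toOp P (stdVec l))) (β y) := by
      rw [hG.innerForm_comm hy, innerForm_eq_dotForm hP]
      simp only [hG.innerForm_comm hy _ (β y)]
      simp only [innerForm_eq_dotForm hP, ← dotFormL_apply]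
      rw [hS, ← map_sum]
      congr 1
      ext x
      simp only [ContinuousAlternatingMap.compContinuousLinearMap_apply,
        ContinuousAlternatingMap.sum_apply]
    rw [this]
    exact Finset.sum_nonpos fun l _ => innerForm_hess_nonpos hG hy hβ hmax _
  have hhess : ∀ x, ∑ i, hess (gam G) β y (stdVec i) (toOp (G y)⁻¹ (stdVec i)) x = S x := by
    intro x
    have := sum_bilin_toOp (LinearMap.mk₂ ℝ (fun u v => hess (gam G) β y u v)
      (by intros; simp [hess_apply]; abel) (by intros; simp [hess_apply, smul_sub])
      (by intros; simp [hess_apply]; abel) (by intros; simp [hess_apply, smul_sub])) hP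
    simp only [LinearMap.mk₂_apply] at this
    rw [hS, ← this, ContinuousAlternatingMap.sum_apply]
  have hric : ∀ (x : Fin (p + 1) → Coord n) (a : Fin (p + 1)),
      ∑ i, (-1 : ℤ) ^ (a : ℕ) • act (β y) (curvOp (gam G) y (x a) (stdVec i))
        (Matrix.vecCons (toOp (G y)⁻¹ (stdVec i)) (a.removeNth x)) =
      ∑ l, (-1 : ℤ) ^ (a : ℕ) • act (β y) (curvOp (gam G) y (x a) (toOp P (stdVec l)))
        (Matrix.vecCons (toOp P (stdVec l)) (a.removeNth x)) := by
    intro x a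
    rw [← Finset.smul_sum, ← Finset.smul_sum]
    congr 1
    have : ∑ i, (act (β y) (curvOp (gam G) y (x a) (stdVec i))).curryLeft
          (toOp (G y)⁻¹ (stdVec i)) =
        ∑ l, (act (β y) (curvOp (gam G) y (x a) (toOp P (stdVec l)))).curryLeft
          (toOp P (stdVec l)) := sum_bilin_toOp (LinearMap.mk₂ ℝ
      (fun u v => (act (β y) (curvOp (gam G) y (x a) u)).curryLeft v)
      (by intros; simp [curvOp_add_right]) (by intros; simp [curvOp_smul_right])
      (by intros; simp) (by intros; simp)) hP
    have := DFunLike.congr_fun this (a.removeNth x)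
    simpa only [ContinuousAlternatingMap.sum_apply,
      ContinuousAlternatingMap.curryLeft_apply_apply] using this
  have hbound : ∀ I : Fin (p + 1) → Fin n, |(ζ y - S) fun a => toOp P (stdVec (I a))| ≤
      ((p + 1) ^ 2 * n ^ 2 * K) * √(innerForm (G y)⁻¹ (β y) (β y)) := by
    intro I
    rw [ContinuousAlternatingMap.sub_apply, h.apply_eq hG hy hβ, hhess, sub_sub_cancel_left,
      abs_neg]
    rw [Finset.sum_congr rfl fun a _ => hric (fun b => toOp P (stdVec (I b))) a]
    -- One operator `R(x_a, e_l)` acting on a `(p+1)`-form costs `(p+1) n K`. Summing over `p + 1`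
    -- slots and `n` frame vectors produces `(p+1)² n² K`.
    have h1 : ∀ (a : Fin (p + 1)) (l : Fin n), |(-1 : ℤ) ^ (a : ℕ) • act (β y)
        (curvOp (gam G) y (toOp P (stdVec (I a))) (toOp P (stdVec l)))
        (Matrix.vecCons (toOp P (stdVec l)) (a.removeNth fun b => toOp P (stdVec (I b))))| ≤
        (p + 1) * n * K * √(innerForm (G y)⁻¹ (β y) (β y)) := by
      intro a l
      have hv : Matrix.vecCons (toOp P (stdVec l)) (a.removeNth fun b => toOp P (stdVec (I b))) =
          fun b => toOp P (stdVec ((Fin.cons l (a.removeNth I) : Fin (p + 1) → Fin n) b)) := by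
        funext b
        refine Fin.cases ?_ (fun k => ?_) b <;> rfl
      rw [hv, zsmul_eq_mul, abs_mul]
      push_cast
      rw [abs_neg_one_pow, one_mul]
      refine (abs_act_frame_le hP (β y) hK0 (hG.curvOp_frame hy hP (I a) l)
        (fun c d => (hG.abs_riemForm_le hy hP _).trans hK) _).trans_eq ?_
      push_cast
      rfl
    calc _ ≤ ∑ a : Fin (p + 1), ∑ l : Fin n,
          (p + 1) * n * K * √(innerForm (G y)⁻¹ (β y) (β y)) :=
        (Finset.abs_sum_le_sum_abs _ _).trans <| Finset.sum_le_sum fun a _ =>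
          (Finset.abs_sum_le_sum_abs _ _).trans <| Finset.sum_le_sum fun l _ => h1 a l
      _ = _ := by
        simp only [Finset.sum_const, Finset.card_univ, Fintype.card_fin, nsmul_eq_mul]
        push_cast
        ring
  have := innerForm_le_of_abs_le hP (β y) (ζ y - S) hbound
  rw [innerForm_sub_left] at this
  linarith

end Estimate

/-! ### Time derivative of `|H|²` along the flow -/

section Evolution

variable {n p : ℕ}

/-- Each inverse metric contributes `∂ₜg⁻¹ = -g⁻¹ (∂ₜg) g⁻¹`, one slot at a time, so the total is
minus the derivation action of `g⁻¹ ∂ₜg`. -/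
theorem HasDerivWithinAt.innerForm_inv {G : ℝ → Matrix (Fin n) (Fin n) ℝ}
    {β : ℝ → Coord n [⋀^Fin p]→L[ℝ] ℝ} {G' : Matrix (Fin n) (Fin n) ℝ}
    {β' : Coord n [⋀^Fin p]→L[ℝ] ℝ} {s : Set ℝ} {t : ℝ}
    (hG : ∀ i j, HasDerivWithinAt (fun r => G r i j) (G' i j) s t)
    (hβ : HasDerivWithinAt β β' s t) (hu : IsUnit (G t)) {P : Matrix (Fin n) (Fin n) ℝ}
    (hP : P * P.transpose = (G t)⁻¹) :
    HasDerivWithinAt (fun r => innerForm (G r)⁻¹ (β r) (β r))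
      (2 * innerForm (G t)⁻¹ β' (β t) -
        innerForm (G t)⁻¹ (act (β t) (toOp ((G t)⁻¹ * G'))) (β t)) s t := by
  have hcomm : ∀ S W : Coord n [⋀^Fin p]→L[ℝ] ℝ,
      innerForm (G t)⁻¹ S W = innerForm (G t)⁻¹ W S := fun S W => by
    rw [innerForm_eq_dotForm hP, innerForm_eq_dotForm hP, dotForm_comm]
  obtain ⟨L, hL, hLv⟩ := hasFDerivWithinAt_toOp_inv
    (hasFDerivWithinAt_toOp fun i j => (hG i j).hasFDerivWithinAt) hu
  have hr := (hβ.hasFDerivWithinAt.continuousAlternatingMapCompContinuousLinearMap hL).hasDerivWithinAt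
  have hA' : L 1 = -((toOp ((G t)⁻¹ * G')).comp (toOp (G t)⁻¹)) := by
    rw [hLv, sum_smulRight_toOp_apply, toOp_mul]
    simp only [ContinuousLinearMap.toSpanSingleton_apply, one_smul]
    rfl
  have h1 : (β t).fderivCompContinuousLinearMap (toOp (G t)⁻¹) (L 1) =
      - (act (β t) (toOp ((G t)⁻¹ * G'))).compContinuousLinearMap (toOp (G t)⁻¹) := by
    rw [hA', map_neg]
    ext x
    simp only [ContinuousAlternatingMap.neg_apply,
      ContinuousAlternatingMap.compContinuousLinearMap_apply,
      ContinuousAlternatingMap.fderivCompContinuousLinearMap_apply, act_apply]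
    congr 1
    refine Finset.sum_congr rfl fun a _ => congrArg _ ?_
    funext j
    rcases eq_or_ne j a with rfl | h <;> simp [*]
  have hd : HasDerivWithinAt (fun r => dotForm (β r)
      ((β r).compContinuousLinearMap (toOp (G r)⁻¹)))
      (dotForm β' ((β t).compContinuousLinearMap (toOp (G t)⁻¹)) +
        dotForm (β t) (β'.compContinuousLinearMap (toOp (G t)⁻¹) -
          (act (β t) (toOp ((G t)⁻¹ * G'))).compContinuousLinearMap (toOp (G t)⁻¹))) s t := by
    have happ : ∀ (γ : ℝ → Coord n [⋀^Fin p]→L[ℝ] ℝ) (γ' : Coord n [⋀^Fin p]→L[ℝ] ℝ)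
        (x : Fin p → Coord n), HasDerivWithinAt γ γ' s t →
        HasDerivWithinAt (fun r => γ r x) (γ' x) s t := fun γ γ' x h =>
      ((ContinuousAlternatingMap.apply ℝ (Coord n) ℝ x).hasFDerivAt.comp_hasDerivWithinAt t h)
    have hr' : HasDerivWithinAt (fun r => (β r).compContinuousLinearMap (toOp (G r)⁻¹))
        (β'.compContinuousLinearMap (toOp (G t)⁻¹) -
          (act (β t) (toOp ((G t)⁻¹ * G'))).compContinuousLinearMap (toOp (G t)⁻¹)) s t := by
      refine hr.congr_deriv ?_
      rw [sub_eq_add_neg, ← h1]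
      ext x
      simp
    have := HasDerivWithinAt.fun_sum (u := Finset.univ) fun (I : Fin p → Fin n) _ =>
      (happ _ _ (fun a => stdVec (I a)) hβ).mul (happ _ _ (fun a => stdVec (I a)) hr')
    refine this.congr_deriv ?_
    rw [Finset.sum_add_distrib]
    rfl
  refine hd.congr_deriv ?_
  rw [dotForm_sub_right]
  change innerForm _ _ _ + (innerForm _ _ _ - innerForm _ _ _) = _
  rw [hcomm (β t) β', hcomm (β t)]
  ring

/-- Permuting the slots changes both factors by the same sign, so every slot contributes as much as
the first one. There, summing over the remaining indices reconstitutes `h`, and the contribution is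
`∑ h²`. -/
theorem sum_contract_nonneg (S : Coord n [⋀^Fin (p + 1)]→L[ℝ] ℝ) (v : Fin n → Coord n)
    {h : Fin n → Fin n → ℝ}
    (hh : ∀ d i, h d i = ∑ J : Fin p → Fin n, S (fun a => v ((Fin.cons d J : _ → Fin n) a)) *
      S (fun a => v ((Fin.cons i J : _ → Fin n) a))) :
    0 ≤ ∑ I : Fin (p + 1) → Fin n, (∑ b, ∑ d, h d (I b) *
      S (fun a => v (Function.update I b d a))) * S (fun a => v (I a)) := by
  set C : (Fin (p + 1) → Fin n) → ℝ := fun I => S (fun a => v (I a)) with hC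
  have hperm : ∀ (σ : Equiv.Perm (Fin (p + 1))) I J, C (I ∘ σ) * C (J ∘ σ) = C I * C J := by
    intro σ I J
    have h1 : ∀ I, C (I ∘ σ) = (Equiv.Perm.sign σ : ℤ) • C I := fun I =>
      S.toAlternatingMap.map_perm (fun a => v (I a)) σ
    rw [h1, h1, smul_mul_smul_comm]
    rw [← Units.val_mul, Int.units_mul_self, Units.val_one, one_smul]
  have h0 : ∑ I : Fin (p + 1) → Fin n, ∑ d, h d (I 0) * (C (Function.update I 0 d) * C I) =
      ∑ i, ∑ d, h d i * h d i := by
    rw [← (Fin.consEquiv fun _ : Fin (p + 1) => Fin n).sum_comp, Fintype.sum_prod_type]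
    refine Finset.sum_congr rfl fun i _ => ?_
    rw [Finset.sum_comm]
    refine Finset.sum_congr rfl fun d _ => ?_
    conv_rhs => rw [hh, Finset.sum_mul]
    refine Finset.sum_congr rfl fun J _ => ?_
    have hc : Fin.consEquiv (fun _ : Fin (p + 1) => Fin n) (i, J) = Fin.cons i J := rfl
    rw [hc, Fin.cons_zero, Fin.update_cons_zero, mul_comm, ← hh d i]
  have hb : ∀ b, ∑ I : Fin (p + 1) → Fin n, ∑ d, h d (I b) * (C (Function.update I b d) * C I) =
      ∑ I : Fin (p + 1) → Fin n, ∑ d, h d (I 0) * (C (Function.update I 0 d) * C I) := by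
    intro b
    refine Fintype.sum_equiv ((Equiv.swap 0 b).arrowCongr (Equiv.refl _)) _ _ fun I => ?_
    refine Finset.sum_congr rfl fun d _ => ?_
    have hI : (Equiv.swap 0 b).arrowCongr (Equiv.refl (Fin n)) I = I ∘ Equiv.swap 0 b := by
      funext a
      simp
    have hu : Function.update (I ∘ Equiv.swap 0 b) 0 d =
        Function.update I b d ∘ Equiv.swap 0 b := by
      rw [Function.update_comp_equiv]
      simp
    rw [hI, hu, hperm]
    simp
  have : ∑ I : Fin (p + 1) → Fin n, (∑ b, ∑ d, h d (I b) * C (Function.update I b d)) * C I =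
      ∑ b : Fin (p + 1), ∑ i, ∑ d, h d i * h d i := by
    rw [← h0, ← Finset.sum_congr rfl fun b _ => hb b, Finset.sum_comm]
    simp only [Finset.sum_mul, mul_assoc]
  refine le_of_le_of_eq ?_ this.symm
  exact Finset.sum_nonneg fun _ _ => Finset.sum_nonneg fun _ _ => Finset.sum_nonneg fun _ _ =>
    mul_self_nonneg _

theorem sum_fin_two_arrow (F : (Fin 2 → Fin n) → ℝ) : ∑ I, F I = ∑ k, ∑ l, F ![k, l] := by
  rw [← (finTwoArrowEquiv (Fin n)).symm.sum_comp, Fintype.sum_prod_type]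
  rfl

/-- The components in a frame of the tensor `g^{kp} g^{lq} H_{ikl} H_{jpq}`. -/
theorem sum_contract_frame {A P : Matrix (Fin n) (Fin n) ℝ} (hP : P * P.transpose = A)
    (S : Coord n [⋀^Fin 3]→L[ℝ] ℝ) (d c : Fin n) :
    ∑ i, ∑ j, P i d * P j c * ∑ k, ∑ l, ∑ p, ∑ q, A k p * A l q * comps S ![i, k, l] *
        comps S ![j, p, q] =
      ∑ J : Fin 2 → Fin n, S (fun a => toOp P (stdVec ((Fin.cons d J : _ → Fin n) a))) *
        S (fun a => toOp P (stdVec ((Fin.cons c J : _ → Fin n) a))) := by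
  have hA : A.transpose = A := by
    rw [← hP, Matrix.transpose_mul, Matrix.transpose_transpose]
  have hS : ∀ i k l, comps (S.curryLeft (stdVec i)) ![k, l] = comps S ![i, k, l] := by
    intro i k l
    refine congrArg S (funext fun a => ?_)
    fin_cases a <;> rfl
  have h1 : ∀ i j, ∑ k, ∑ l, ∑ p, ∑ q, A k p * A l q * comps S ![i, k, l] * comps S ![j, p, q] =
      innerForm A (S.curryLeft (stdVec i)) (S.curryLeft (stdVec j)) := by
    intro i j
    rw [innerForm, ← tensorInner_comps _ hA, tensorInner]
    simp only [sum_fin_two_arrow, hS, Fin.prod_univ_two]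
    rfl
  have hsum : ∀ u w, innerForm A (S.curryLeft u) (S.curryLeft w) = ∑ J : Fin 2 → Fin n,
      S (Matrix.vecCons u fun a => toOp P (stdVec (J a))) *
        S (Matrix.vecCons w fun a => toOp P (stdVec (J a))) := fun u w =>
    innerForm_eq_sum hP _ _
  have h2 : innerForm A (S.curryLeft (toOp P (stdVec d))) (S.curryLeft (toOp P (stdVec c))) =
      ∑ i, ∑ j, (P i d * P j c) • innerForm A (S.curryLeft (stdVec i)) (S.curryLeft (stdVec j)) :=
    bilin_toOp_stdVec (LinearMap.mk₂ ℝ (fun u w => innerForm A (S.curryLeft u) (S.curryLeft w))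
      (by intros; simp [innerForm, dotForm, add_mul, Finset.sum_add_distrib])
      (by intros; simp [innerForm, dotForm, Finset.mul_sum, mul_assoc])
      (by intros; simp [innerForm, dotForm, mul_add, Finset.sum_add_distrib])
      (by intros; simp [innerForm, dotForm, Finset.mul_sum, mul_left_comm])) P d c
  simp only [h1]
  refine h2.symm.trans ((hsum _ _).trans ?_)
  have hv : ∀ (d : Fin n) (J : Fin 2 → Fin n),
      (Matrix.vecCons (toOp P (stdVec d)) fun a => toOp P (stdVec (J a))) =
        fun a => toOp P (stdVec ((Fin.cons d J : Fin 3 → Fin n) a)) := by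
    intro d J
    funext a
    refine Fin.cases ?_ (fun k => ?_) a <;> rfl
  simp only [hv]

/-- Relative to the frame `P`, the endomorphism `g⁻¹B` has matrix `PᵀBP`, the frame components of
the bilinear form `B`. -/
theorem toOp_mul_frame {A P : Matrix (Fin n) (Fin n) ℝ} (hP : P * P.transpose = A)
    (B : Matrix (Fin n) (Fin n) ℝ) (d : Fin n) :
    toOp (A * B) (toOp P (stdVec d)) =
      ∑ c, (∑ i, ∑ j, P i c * P j d * B i j) • toOp P (stdVec c) := by
  have h : toOp (A * B) (toOp P (stdVec d)) = toOp P (toOp (P.transpose * B * P) (stdVec d)) := by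
    have : A * B * P = P * (P.transpose * B * P) := by
      rw [← hP]
      simp only [Matrix.mul_assoc]
    have h2 := congrArg (fun m => toOp m (stdVec d)) this
    simpa only [toOp_mul, ContinuousLinearMap.comp_apply] using h2
  rw [h, toOp_stdVec, map_sum]
  refine Finset.sum_congr rfl fun c _ => ?_
  rw [map_smul]
  congr 1
  simp only [Matrix.mul_apply, Matrix.transpose_apply, Finset.sum_mul]
  rw [Finset.sum_comm]
  exact Finset.sum_congr rfl fun i _ => Finset.sum_congr rfl fun j _ => by ring

/-- At a spatial maximum of `|H|²`, the time derivative of `|H|²` along the generalized Ricci flow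
is bounded by `24 n⁵ |Rm| |H|²`. -/
theorem exists_hasDerivWithinAt_innerForm_le {G : ℝ → Coord n → Matrix (Fin n) (Fin n) ℝ}
    {β : ℝ → Coord n → Coord n [⋀^Fin 3]→L[ℝ] ℝ} {ζ : Coord n → Coord n [⋀^Fin 3]→L[ℝ] ℝ}
    {U : Set (Coord n)} {y : Coord n} {s : Set ℝ} {t K : ℝ} (hG : MetricOn (G t) U) (hy : y ∈ U)
    (hβ : ContDiffOn ℝ ∞ (β t) U) (hζ : IsLaplaceBeltrami (G t) U (β t) ζ)
    (hβ' : HasDerivWithinAt (fun r => β r y) (ζ y) s t)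
    (hG' : ∀ i j, HasDerivWithinAt (fun r => G r y i j) (-2 * ricci (G t) i j y
      + (1 / 2 : ℝ) * ∑ k, ∑ l, ∑ p, ∑ q, (G t y)⁻¹ k p * (G t y)⁻¹ l q
        * comps (β t y) ![i, k, l] * comps (β t y) ![j, p, q]) s t)
    (hmax : IsLocalMax (fun z => innerForm (G t z)⁻¹ (β t z) (β t z)) y)
    (hK : tensorNorm (G t y)⁻¹
      (fun I : Fin 4 → Fin n => riem (G t) (I 0) (I 1) (I 2) (I 3) y) ≤ K) :
    ∃ D, HasDerivWithinAt (fun r => innerForm (G r y)⁻¹ (β r y) (β r y)) D s t ∧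
      D ≤ 24 * n ^ 5 * K * innerForm (G t y)⁻¹ (β t y) (β t y) := by
  obtain ⟨P, hP⟩ := hG.exists_frame hy
  set A := (G t y)⁻¹ with hA
  set R : Matrix (Fin n) (Fin n) ℝ := Matrix.of fun i j => ricci (G t) i j y with hR
  set Q : Matrix (Fin n) (Fin n) ℝ := Matrix.of fun i j => ∑ k, ∑ l, ∑ p, ∑ q, A k p * A l q
    * comps (β t y) ![i, k, l] * comps (β t y) ![j, p, q] with hQ
  set S := β t y with hS
  have hK0 : 0 ≤ K := (Real.sqrt_nonneg _).trans hK
  have hder := HasDerivWithinAt.innerForm_inv (G := fun r => G r y) (β := fun r => β r y)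
    (G' := (-2 : ℝ) • R + (1 / 2 : ℝ) • Q) (fun i j => hG' i j) hβ' (hG.isUnit hy) hP
  refine ⟨_, hder, ?_⟩
  have hlap := hζ.innerForm_le hG hy hβ hmax hK
  have hact : act S (toOp (A * ((-2 : ℝ) • R + (1 / 2 : ℝ) • Q))) =
      (-2 : ℝ) • act S (toOp (A * R)) + (1 / 2 : ℝ) • act S (toOp (A * Q)) := by
    have hm : ∀ (c : ℝ) (f : Matrix (Fin n) (Fin n) ℝ), toOp (c • f) = c • toOp f :=
      fun c f => map_smul (Matrix.toEuclideanCLM (n := Fin n) (𝕜 := ℝ)) c f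
    rw [mul_add, Matrix.mul_smul, Matrix.mul_smul, toOp_add, hm, hm, map_add, map_smul, map_smul]
  have hin : innerForm A (act S (toOp (A * ((-2 : ℝ) • R + (1 / 2 : ℝ) • Q)))) S =
      -2 * innerForm A (act S (toOp (A * R))) S + 1 / 2 * innerForm A (act S (toOp (A * Q))) S := by
    rw [hact]
    simp only [innerForm, dotForm_comm _ (S.compContinuousLinearMap (toOp A))]
    simp only [← dotFormL_apply]
    rw [map_add, map_smul, map_smul, smul_eq_mul, smul_eq_mul]
  have hric : innerForm A (act S (toOp (A * R))) S ≤
      n ^ 3 * (3 * n * (n * K)) * innerForm A S S := by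
    refine innerForm_le_of_abs_le hP S _ fun I => ?_
    have := abs_act_frame_le hP S (mul_nonneg n.cast_nonneg hK0) (toOp_mul_frame hP R)
      (fun c d => (hG.abs_sum_ricci_le hy hP c d).trans
        (mul_le_mul_of_nonneg_left hK n.cast_nonneg)) I
    exact_mod_cast this
  have hquad : 0 ≤ innerForm A (act S (toOp (A * Q))) S := by
    rw [innerForm_eq_sum hP]
    have := sum_contract_nonneg S (fun i => toOp P (stdVec i))
      (fun d i => sum_contract_frame hP S d i)
    refine this.trans_eq (Finset.sum_congr rfl fun I _ => ?_)
    rw [act_frame_eq_sum S (toOp_mul_frame hP Q)]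
    rfl
  change 2 * innerForm A (ζ y) S - innerForm A (act S (toOp (A * _))) S ≤ _
  rw [hin]
  norm_num at hlap
  -- The constant is `2 · 9` from the Weitzenböck term, with `(p+1)² = 9`, plus `2 · 3` from `-2
  -- Ric`; the quadratic term enters with coefficient `-½` and is dropped.
  nlinarith [hlap, hric, hquad]

end Evolution

/-! ### A parabolic maximum principle on a compact space -/

section MaximumPrinciple

/-- A maximum principle: if the time derivative of `u ≥ 0` is at most `c u` at every spatial
maximum, then `u` grows at most like `exp (c t)`. -/
theorem le_mul_exp_of_deriv_le_at_max {M : Type*} [TopologicalSpace M] [CompactSpace M]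
    {u : M → ℝ → ℝ} {T c B : ℝ}
    (hu : ContinuousOn (fun z : M × ℝ => u z.1 z.2) (univ ×ˢ Icc 0 T))
    (h0 : ∀ x, u x 0 ≤ B)
    (hmax : ∀ x, ∀ t ∈ Icc 0 T, (∀ z, u z t ≤ u x t) →
      ∃ D, HasDerivWithinAt (u x) D (Icc 0 T) t ∧ D ≤ c * u x t)
    (x : M) {t : ℝ} (ht : t ∈ Icc 0 T) : u x t ≤ B * Real.exp (c * t) := by
  have key : ∀ ε > 0, Real.exp (-c * t) * u x t - ε * t ≤ B := by
    intro ε hε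
    -- The exponential absorbs the growth rate `c`, and `-ε t` makes the inequality strict, so a
    -- maximum of `w` cannot occur at a positive time.
    set w : M → ℝ → ℝ := fun x t => Real.exp (-c * t) * u x t - ε * t with hw
    have hwc : ContinuousOn (fun z : M × ℝ => w z.1 z.2) (univ ×ˢ Icc 0 T) := by
      refine ContinuousOn.sub (ContinuousOn.mul ?_ hu) ?_ <;>
      exact Continuous.continuousOn (by fun_prop)
    obtain ⟨⟨x₁, t₁⟩, ⟨-, ht₁⟩, h₁⟩ := (isCompact_univ.prod isCompact_Icc).exists_isMaxOn
      ⟨(x, t), mem_univ _, ht⟩ hwc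
    have hle : ∀ z, ∀ s ∈ Icc 0 T, w z s ≤ w x₁ t₁ := fun z s hs =>
      h₁ (a := (z, s)) ⟨mem_univ _, hs⟩
    refine (hle x t ht).trans ?_
    rcases ht₁.1.eq_or_lt with h | hpos
    · subst h
      simpa [hw] using h0 x₁
    exfalso
    obtain ⟨D, hD, hDle⟩ := hmax x₁ t₁ ht₁ fun z => by
      have := hle z t₁ ht₁
      simp only [hw, sub_le_sub_iff_right] at this
      exact le_of_mul_le_mul_left this (Real.exp_pos _)
    have hexp : HasDerivAt (fun s => Real.exp (-c * s)) (Real.exp (-c * t₁) * (-c)) t₁ := by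
      simpa using ((hasDerivAt_id t₁).const_mul (-c)).exp
    have hwd : HasDerivWithinAt (w x₁) (Real.exp (-c * t₁) * (-c) * u x₁ t₁ +
        Real.exp (-c * t₁) * D - ε * 1) (Icc 0 T) t₁ :=
      (hexp.hasDerivWithinAt.mul hD).sub ((hasDerivWithinAt_id t₁ _).const_mul ε)
    have hloc : IsLocalMaxOn (w x₁) (Icc 0 T) t₁ :=
      Filter.eventually_of_mem self_mem_nhdsWithin fun s hs => hle x₁ s hs
    -- The backward direction is admissible even when the maximum sits at `t₁ = T`. There it forces
    -- the one-sided time derivative to be nonnegative, whereas it is at most `-ε`.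
    have hcone : 0 - t₁ ∈ posTangentConeAt (Icc 0 T) t₁ :=
      sub_mem_posTangentConeAt_of_segment_subset
        ((convex_Icc 0 T).segment_subset ht₁ ⟨le_rfl, ht₁.1.trans ht₁.2⟩)
    have hneg := hloc.hasFDerivWithinAt_nonpos hwd.hasFDerivWithinAt hcone
    simp only [ContinuousLinearMap.toSpanSingleton_apply, smul_eq_mul] at hneg
    have : Real.exp (-c * t₁) * D ≤ Real.exp (-c * t₁) * (c * u x₁ t₁) :=
      mul_le_mul_of_nonneg_left hDle (Real.exp_pos _).le
    nlinarith
  have hlim : Real.exp (-c * t) * u x t ≤ B := by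
    refine le_of_forall_pos_le_add fun δ hδ => ?_
    have ht1 : 0 < t + 1 := by linarith [ht.1]
    -- Dividing by `t + 1` rather than `t` allows `t = 0`.
    have := key (δ / (t + 1)) (by positivity)
    have h2 : δ / (t + 1) * t ≤ δ := by
      rw [div_mul_eq_mul_div, div_le_iff₀ ht1]
      nlinarith
    linarith
  calc u x t = Real.exp (-c * t) * u x t * Real.exp (c * t) := by
        rw [mul_right_comm, ← Real.exp_add]
        simp
    _ ≤ _ := mul_le_mul_of_nonneg_right hlim (Real.exp_pos _).le

end MaximumPrinciple

/-! ### Independence of the chart -/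

section Charts

variable {n p : ℕ} {M : Type*} [TopologicalSpace M] [ChartedSpace (Coord n) M]

theorem mdifferentiable_of_mem_maximalAtlas {e : OpenPartialHomeomorph M (Coord n)}
    (he : e ∈ IsManifold.maximalAtlas 𝓘(ℝ, Coord n) ∞ M) :
    e.MDifferentiable 𝓘(ℝ, Coord n) 𝓘(ℝ, Coord n) :=
  ⟨fun _ hx => ((contMDiffAt_of_mem_maximalAtlas he hx).mdifferentiableAt
      (by simp)).mdifferentiableWithinAt,
    fun _ hx => ((contMDiffAt_symm_of_mem_maximalAtlas he hx).mdifferentiableAt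
      (by simp)).mdifferentiableWithinAt⟩

theorem chartInvDeriv_bijective {e : OpenPartialHomeomorph M (Coord n)}
    (he : e ∈ IsManifold.maximalAtlas 𝓘(ℝ, Coord n) ∞ M) {y : Coord n} (hy : y ∈ e.target) :
    Function.Bijective (chartInvDeriv e y) :=
  (mdifferentiable_of_mem_maximalAtlas he).symm.mfderiv_bijective hy

variable [IsManifold 𝓘(ℝ, Coord n) ∞ M]

/-- The Gram matrix of the image of the standard basis under `L : ℝⁿ → TₓM`. -/
def gram (g : RiemMetric n M) (x : M) (L : Coord n →L[ℝ] TangentSpace 𝓘(ℝ, Coord n) x) :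
    Matrix (Fin n) (Fin n) ℝ :=
  Matrix.of fun i j => g.inner x (L (stdVec i)) (L (stdVec j))

theorem posDef_gram (g : RiemMetric n M) {x : M}
    {L : Coord n →L[ℝ] TangentSpace 𝓘(ℝ, Coord n) x} (hL : Function.Injective L) :
    (gram g x L).PosDef := by
  refine Matrix.PosDef.of_dotProduct_mulVec_pos ?_ fun v hv => ?_
  · ext i j
    exact g.symm x _ _
  · have h : star v ⬝ᵥ ((gram g x L).mulVec v) =
        g.inner x (L (∑ i, v i • stdVec i)) (L (∑ i, v i • stdVec i)) := by
      simp only [map_sum, map_smul, _root_.sum_apply, _root_.smul_apply, dotProduct,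
        Matrix.mulVec, gram, Matrix.of_apply, Finset.mul_sum, smul_eq_mul]
      rw [Finset.sum_comm]
      refine Finset.sum_congr rfl fun i _ => Finset.sum_congr rfl fun j _ => ?_
      simp
      ring
    rw [h]
    refine g.pos x _ fun h0 => hv ?_
    have h1 : (∑ i, v i • stdVec i : Coord n) = 0 := hL (by rw [h0, map_zero])
    funext i
    exact congrArg (fun z : Coord n => z i)
      ((sum_smul_stdVec (WithLp.toLp 2 v : Coord n)).symm.trans h1)

theorem innerForm_mul_transpose (A Q : Matrix (Fin n) (Fin n) ℝ)
    (S W : Coord n [⋀^Fin p]→L[ℝ] ℝ) : innerForm (Q * A * Q.transpose) S W =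
      innerForm A (S.compContinuousLinearMap (toOp Q)) (W.compContinuousLinearMap (toOp Q)) := by
  unfold innerForm
  rw [dotForm_comp, ← toOp_transpose]
  congr 1
  ext x
  simp only [ContinuousAlternatingMap.compContinuousLinearMap_apply, toOp_mul,
    ContinuousLinearMap.coe_comp, Function.comp_assoc]

/-- The pointwise norm of a form does not depend on the basis used to compute it. -/
theorem innerForm_gram_eq (g : RiemMetric n M) (H : DiffForm n p M) {x x' : M} (hx : x = x')
    {L : Coord n →L[ℝ] TangentSpace 𝓘(ℝ, Coord n) x}
    {L' : Coord n →L[ℝ] TangentSpace 𝓘(ℝ, Coord n) x'} (hL : Function.Surjective L)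
    (hL' : Function.Injective L') :
    innerForm (gram g x L)⁻¹ ((H x).compContinuousLinearMap L)
        ((H x).compContinuousLinearMap L) =
      innerForm (gram g x' L')⁻¹ ((H x').compContinuousLinearMap L')
        ((H x').compContinuousLinearMap L') := by
  subst hx
  -- `Q` is the change of basis from `L` to `L'`. The Gram matrix changes by congruence and the form
  -- by precomposition, so the effects on the norm cancel.
  choose v hv using fun i => hL (L' (stdVec i))
  set Q : Matrix (Fin n) (Fin n) ℝ := Matrix.of fun k i => v i k with hQ
  have hQv : ∀ i, toOp Q (stdVec i) = v i := fun i => by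
    rw [toOp_stdVec]
    exact sum_smul_stdVec (v i)
  have hLQ : L' = L.comp (toOp Q) := by
    ext w
    rw [← sum_smul_stdVec w, map_sum, map_sum]
    refine Finset.sum_congr rfl fun i _ => ?_
    rw [map_smul, map_smul, ContinuousLinearMap.comp_apply, hQv, hv]
  have hgram : gram g x L' = Q.transpose * gram g x L * Q := by
    ext i j
    have : ∀ i, L' (stdVec i) = ∑ k, Q k i • L (stdVec k) := fun i => by
      rw [hLQ, ContinuousLinearMap.comp_apply, toOp_stdVec, map_sum]
      simp only [map_smul]
    simp only [gram, Matrix.of_apply, this, map_sum, map_smul, _root_.sum_apply,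
      _root_.smul_apply, Matrix.mul_apply, Matrix.transpose_apply, Finset.sum_mul, smul_eq_mul,
      Finset.mul_sum]
    refine Finset.sum_congr rfl fun k _ => Finset.sum_congr rfl fun l _ => ?_
    ring
  -- Invertibility of `Q` is read off from the congruence, because the Gram matrix of the injective
  -- `L'` is positive definite.
  have hu : IsUnit Q.det := by
    have := ((Matrix.isUnit_iff_isUnit_det _).1 (posDef_gram g hL').isUnit)
    rw [hgram, Matrix.det_mul] at this
    exact isUnit_of_mul_isUnit_right this
  have hinv : Q * (gram g x L')⁻¹ * Q.transpose = (gram g x L)⁻¹ := by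
    rw [hgram, Matrix.mul_inv_rev, Matrix.mul_inv_rev, ← Matrix.mul_assoc, ← Matrix.mul_assoc,
      Matrix.mul_nonsing_inv _ hu, one_mul, Matrix.mul_assoc,
      Matrix.nonsing_inv_mul _ (by rwa [Matrix.det_transpose]), mul_one]
  have hS : (H x).compContinuousLinearMap L' =
      ((H x).compContinuousLinearMap L).compContinuousLinearMap (toOp Q) := by
    rw [hLQ]
    rfl
  rw [hS, ← hinv]
  exact innerForm_mul_transpose _ _ _ _

theorem metricOn_localMetric {g : RiemMetric n M} {e : OpenPartialHomeomorph M (Coord n)}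
    (he : e ∈ IsManifold.maximalAtlas 𝓘(ℝ, Coord n) ∞ M)
    (hg : ∀ i j, ContDiffOn ℝ ∞ (fun y => localMetric g e y i j) e.target) :
    MetricOn (localMetric g e) e.target :=
  ⟨e.open_target, hg, fun _ hy => posDef_gram g (chartInvDeriv_bijective he hy).1⟩

/-- The pointwise norm `|H|²` computed in the chart `e`. -/
def chartNormSq (g : RiemMetric n M) (H : DiffForm n p M)
    (e : OpenPartialHomeomorph M (Coord n)) (y : Coord n) : ℝ :=
  innerForm (localMetric g e y)⁻¹ (localForm H e y) (localForm H e y)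

theorem chartNormSq_eq (g : RiemMetric n M) (H : DiffForm n p M)
    {e e' : OpenPartialHomeomorph M (Coord n)}
    (he : e ∈ IsManifold.maximalAtlas 𝓘(ℝ, Coord n) ∞ M)
    (he' : e' ∈ IsManifold.maximalAtlas 𝓘(ℝ, Coord n) ∞ M) {y y' : Coord n} (hy : y ∈ e.target)
    (hy' : y' ∈ e'.target) (h : e.symm y = e'.symm y') :
    chartNormSq g H e y = chartNormSq g H e' y' :=
  innerForm_gram_eq g H h (chartInvDeriv_bijective he hy).2 (chartInvDeriv_bijective he' hy').1

theorem chartNormSq_eq_tensorInner (g : RiemMetric n M) (H : DiffForm n p M)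
    {e : OpenPartialHomeomorph M (Coord n)}
    (he : e ∈ IsManifold.maximalAtlas 𝓘(ℝ, Coord n) ∞ M) {y : Coord n} (hy : y ∈ e.target) :
    chartNormSq g H e y =
      tensorInner (localMetric g e y)⁻¹ (comps (localForm H e y)) (comps (localForm H e y)) := by
  have hpd := posDef_gram g (chartInvDeriv_bijective he hy).1
  refine (tensorInner_comps _ ?_ _ _).symm
  rw [Matrix.transpose_nonsing_inv]
  congr 1
  have := hpd.isHermitian
  rwa [Matrix.IsHermitian, Matrix.conjTranspose_eq_transpose_of_trivial] at this

/-- The pointwise norm `|H|²`. -/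
def normSq (g : RiemMetric n M) (H : DiffForm n p M) (x : M) : ℝ :=
  chartNormSq g H (chartAt (Coord n) x) (chartAt (Coord n) x x)

theorem normSq_eq_chartNormSq (g : RiemMetric n M) (H : DiffForm n p M)
    {e : OpenPartialHomeomorph M (Coord n)}
    (he : e ∈ IsManifold.maximalAtlas 𝓘(ℝ, Coord n) ∞ M) {x : M} (hx : x ∈ e.source) :
    normSq g H x = chartNormSq g H e (e x) :=
  chartNormSq_eq g H (IsManifold.chart_mem_maximalAtlas x) he (mem_chart_target _ x)
    (e.map_source hx) (by rw [e.left_inv hx, (chartAt (Coord n) x).left_inv (mem_chart_source _ x)])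

theorem normForm_eq_sqrt (g : RiemMetric n M) (H : DiffForm n p M) (x : M) :
    normForm g H x = √(normSq g H x) := by
  rw [normSq, chartNormSq_eq_tensorInner g H (IsManifold.chart_mem_maximalAtlas x)
    (mem_chart_target _ x)]
  rfl

end Charts

/-! ### The maximum principle applied to a solution -/

section Solution

variable {n : ℕ} {M : Type*} [TopologicalSpace M] [ChartedSpace (Coord n) M]
  [IsManifold 𝓘(ℝ, Coord n) ∞ M] {T : ℝ} {g : ℝ → RiemMetric n M} {H : ℝ → DiffForm n 3 M}

theorem contDiffOn_slice {E F : Type*} [NormedAddCommGroup E] [NormedSpace ℝ E]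
    [NormedAddCommGroup F] [NormedSpace ℝ F] {f : E × ℝ → F} {U : Set E} {I : Set ℝ}
    (hf : ContDiffOn ℝ ∞ f (U ×ˢ I)) {t : ℝ} (ht : t ∈ I) :
    ContDiffOn ℝ ∞ (fun y => f (y, t)) U :=
  hf.comp (contDiff_id.prodMk contDiff_const).contDiffOn fun _ hy => ⟨hy, ht⟩

theorem IsSolution.metricOn (h : IsSolution T g H) {e : OpenPartialHomeomorph M (Coord n)}
    (he : e ∈ IsManifold.maximalAtlas 𝓘(ℝ, Coord n) ∞ M) {t : ℝ} (ht : t ∈ Icc 0 T) :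
    MetricOn (localMetric (g t) e) e.target :=
  metricOn_localMetric he fun i j => contDiffOn_slice (h.smooth_metric e he i j) ht

theorem IsSolution.continuousOn_chartNormSq (h : IsSolution T g H)
    {e : OpenPartialHomeomorph M (Coord n)}
    (he : e ∈ IsManifold.maximalAtlas 𝓘(ℝ, Coord n) ∞ M) :
    ContinuousOn (fun z : Coord n × ℝ => chartNormSq (g z.2) (H z.2) e z.1)
      (e.target ×ˢ Icc 0 T) := by
  have hinv : ContinuousOn (fun z : Coord n × ℝ => toOp (localMetric (g z.2) e z.1)⁻¹)
      (e.target ×ˢ Icc 0 T) :=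
    (contDiffOn_toOp_inv (N := ∞) (fun i j => h.smooth_metric e he i j)
      fun z hz => (h.metricOn he hz.2).isUnit hz.1).continuousOn
  have hentry : ∀ i j, ContinuousOn
      (fun z : Coord n × ℝ => (localMetric (g z.2) e z.1)⁻¹ i j) (e.target ×ˢ Icc 0 T) := by
    intro i j
    have h1 := (EuclideanSpace.proj i : Coord n →L[ℝ] ℝ).continuous.comp_continuousOn
      (hinv.clm_apply (continuousOn_const (c := (stdVec j : Coord n))))
    refine h1.congr fun z _ => ?_
    simp [toOp_stdVec, stdVec_apply]
  have hcomp : ∀ I, ContinuousOn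
      (fun z : Coord n × ℝ => comps (localForm (H z.2) e z.1) I) (e.target ×ˢ Icc 0 T) :=
    fun I => (ContinuousAlternatingMap.apply ℝ (Coord n) ℝ
      fun a => stdVec (I a)).continuous.comp_continuousOn (h.smooth_form e he).continuousOn
  refine ContinuousOn.congr ?_ fun z hz => chartNormSq_eq_tensorInner (g z.2) (H z.2) he hz.1
  exact continuousOn_finsetSum _ fun I _ => continuousOn_finsetSum _ fun J _ =>
    ((continuousOn_finsetProd _ fun a _ => hentry _ _).mul (hcomp I)).mul (hcomp J)

/-- `normSq` uses a chart that varies with the point, so its continuity is not immediate; near `x`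
it is rewritten in the one fixed chart at `x`. -/
theorem IsSolution.continuousOn_normSq (h : IsSolution T g H) :
    ContinuousOn (fun z : M × ℝ => normSq (g z.2) (H z.2) z.1) (univ ×ˢ Icc 0 T) := by
  rintro ⟨x, t⟩ ⟨-, ht⟩
  set e := chartAt (Coord n) x with he'
  have he : e ∈ IsManifold.maximalAtlas 𝓘(ℝ, Coord n) ∞ M := IsManifold.chart_mem_maximalAtlas x
  have h1 : ContinuousOn (fun z : M × ℝ => normSq (g z.2) (H z.2) z.1) (e.source ×ˢ Icc 0 T) := by
    have h2 : ContinuousOn (fun z : M × ℝ => (e z.1, z.2)) (e.source ×ˢ Icc 0 T) :=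
      (e.continuousOn.comp continuousOn_fst fun z hz => hz.1).prodMk continuousOn_snd
    refine ((h.continuousOn_chartNormSq he).comp h2 fun z hz =>
      ⟨e.map_source hz.1, hz.2⟩).congr fun z hz => ?_
    exact normSq_eq_chartNormSq _ _ he hz.1
  have hx : x ∈ e.source := mem_chart_source _ x
  refine (h1 (x, t) ⟨hx, ht⟩).mono_of_mem_nhdsWithin ?_
  refine mem_nhdsWithin.2 ⟨e.source ×ˢ univ, e.open_source.prod isOpen_univ, ⟨hx, mem_univ _⟩, ?_⟩
  rintro ⟨z, s⟩ ⟨⟨h3, -⟩, -, h4⟩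
  exact ⟨h3, h4⟩

/-- The evolution of `|H|²` at a spatial maximum. -/
theorem IsSolution.exists_hasDerivWithinAt_normSq_le (h : IsSolution T g H) {x : M} {t K : ℝ}
    (ht : t ∈ Icc 0 T) (hK : normRm (g t) x ≤ K)
    (hmax : ∀ z, normSq (g t) (H t) z ≤ normSq (g t) (H t) x) :
    ∃ D, HasDerivWithinAt (fun s => normSq (g s) (H s) x) D (Icc 0 T) t ∧
      D ≤ 24 * n ^ 5 * K * normSq (g t) (H t) x := by
  set e := chartAt (Coord n) x with he'
  have he : e ∈ IsManifold.maximalAtlas 𝓘(ℝ, Coord n) ∞ M := IsManifold.chart_mem_maximalAtlas x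
  have hy : e x ∈ e.target := mem_chart_target _ x
  obtain ⟨ζ, hζ, hβ'⟩ := h.evol_form e he t ht
  refine exists_hasDerivWithinAt_innerForm_le (G := fun s => localMetric (g s) e)
    (β := fun s => localForm (H s) e) (h.metricOn he ht) hy
    (contDiffOn_slice (h.smooth_form e he) ht) hζ (hβ' _ hy)
    (fun i j => h.evol_metric e he _ hy t ht i j) ?_ hK
  -- Chart independence turns the global maximum on `M` into a local maximum of the coordinate
  -- expression in this single chart.
  refine Filter.eventually_of_mem (e.open_target.mem_nhds hy) fun z hz => ?_
  have hz' := hmax (e.symm z)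
  rw [normSq_eq_chartNormSq _ _ he (e.map_target hz), e.right_inv hz] at hz'
  exact hz'

end Solution

end GRF

end

theorem theorem4p5 (n : ℕ) :
    ∃ C : ℝ, ∀ (M : Type*) [TopologicalSpace M] [T2Space M] [CompactSpace M]
      [ChartedSpace (GRF.Coord n) M] [IsManifold 𝓘(ℝ, GRF.Coord n) ∞ M]
      (T : ℝ) (g : ℝ → GRF.RiemMetric n M) (H : ℝ → GRF.DiffForm n 3 M) (K₁ K₂ : ℝ),
      GRF.IsSolution T g H → 0 ≤ K₁ → 0 ≤ K₂ →
      (∀ x : M, ∀ t ∈ Icc 0 T, GRF.normRm (g t) x ≤ K₁) →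
      (∀ x : M, GRF.normForm (g 0) (H 0) x ≤ K₂) →
      ∀ x : M, ∀ t ∈ Icc 0 T, GRF.normForm (g t) (H t) x ≤ K₂ * Real.exp (C * K₁ * t) := by
  -- Half of the rate `24 n⁵` for `|H|²`, since the final bound is on `|H|`.
  refine ⟨12 * n ^ 5, fun M _ _ _ _ _ T g H K₁ K₂ h hK₁ hK₂ hRm hH x t ht => ?_⟩
  have hu := GRF.le_mul_exp_of_deriv_le_at_max (u := fun x s => GRF.normSq (g s) (H s) x)
    (B := K₂ ^ 2) (c := 24 * n ^ 5 * K₁) h.continuousOn_normSq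
    (fun x => by
      have := hH x
      rw [GRF.normForm_eq_sqrt] at this
      exact (Real.sqrt_le_left hK₂).1 this)
    (fun x s hs hmax => h.exists_hasDerivWithinAt_normSq_le hs (hRm x s hs) hmax) x ht
  rw [GRF.normForm_eq_sqrt]
  refine Real.sqrt_le_iff.2 ⟨by positivity, hu.trans_eq ?_⟩
  rw [mul_pow, ← Real.exp_nat_mul]
  congr 2
  push_cast
  ring
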